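/- Let $S$ be a regular local ring, let $f \in S$ be a non-zero non-unit, let $n \geq 2$, and set $R^\# = S[y]/(f+y^n)$. Write $\mathrm{MCM}(R^\#)$ for the category of maximal Cohen–Macaulay $R^\#$-modules (including $0$) and $\underline{\mathrm{MCM}}(R^\#)$ for its stable category (morphisms modulo those factoring through a finitely generated free module), a triangulated category whose suspension is the cosyzygy and whose distinguished triangles are those isomorphic to $X \xrightarrow{g} Y \to C \to X'$, where $0 \to X \to F \to X' \to 0$ is an exact sequence of modules with $F$ free of finite rank and $X' \in \mathrm{MCM}(R^\#)$, and $C$ is the pushout of $X \to F$ along a homomorphism $g$. For $1 \le k \le n$ let $$\Sigma_k = \operatorname{add}\{\Omega_{R^\#}(M) \mid M \in \mathrm{MCM}(R^\#/(y^k))\},$$ where $\Omega_{R^\#}(M)$ denotes the kernel of any surjection from a free $R^\#$-module of finite rank onto $M$; write $\Sigma_k$ also for its image (closed under isomorphism) in $\underline{\mathrm{MCM}}(R^\#)$. For full subcategories $\mathcal I, \mathcal J$ of $\underline{\mathrm{MCM}}(R^\#)$ let $\langle \mathcal I\rangle$ be the smallest full subcategory containing $\mathcal I$ and closed under isomorphisms,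 direct summands, finite direct sums and shifts; let $\mathcal I * \mathcal J$ consist of all $Y$ that occur in a distinguished triangle $X_1 \to Y \to X_2 \to X_1[1]$ with $X_1 \in \mathcal I$, $X_2 \in \mathcal J$; and put $\mathcal I \diamond \mathcal J = \langle \mathcal I * \mathcal J\rangle$, $\langle\mathcal I\rangle_0 = \langle \mathcal I\rangle$, $\langle\mathcal I\rangle_{m+1} = \langle\mathcal I\rangle_{m} \diamond \langle\mathcal I\rangle$. Then: (1) in $\underline{\mathrm{MCM}}(R^\#)$, $\Sigma_k = \Sigma_{k-j} \diamond \Sigma_j$ for all $1 \le j < k \le n$; (2) if moreover $n$ is a unit in $S$, then $\mathrm{MCM}(R^\#) = \Sigma_{n-1}$ (as classes of $R^\#$-modules), and $\underline{\mathrm{MCM}}(R^\#) = \Sigma_{n-1} = \langle \Sigma_1 \rangle_{n-2}$ in the stable category. -/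

import Mathlib

open CategoryTheory CategoryTheory.Limits Polynomial

universe u

namespace BranchedCover

/-! ### Maximal Cohen-Macaulay modules and syzygies -/

/-- Maximal Cohen-Macaulay modules over a Noetherian local ring `Q`: finitely generated modules
that are zero or have depth `dim Q`, that is, admit a regular sequence of length `dim Q` in the
maximal ideal (the maximal ideal of a local ring is its set of nonunits). -/
def IsMCM (Q : Type u) [CommRing Q] : ObjectProperty (ModuleCat.{u} Q) := fun M =>
  Module.Finite Q M ∧
    (Subsingleton M ∨
      ∃ rs : List Q, (∀ r ∈ rs, r ∈ nonunits Q) ∧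
        RingTheory.Sequence.IsRegular M rs ∧ (rs.length : WithBot ℕ∞) = ringKrullDim Q)

/-- A short exact sequence `0 → X → Q^r → Z → 0`. It exhibits `X` as a first syzygy of `Z`, and
`Z` as a first cosyzygy of `X`. -/
structure SyzygySequence (Q : Type u) [CommRing Q] (X Z : ModuleCat.{u} Q) where
  rank : ℕ
  incl : X ⟶ ModuleCat.of Q (Fin rank → Q)
  proj : ModuleCat.of Q (Fin rank → Q) ⟶ Z
  incl_injective : Function.Injective incl
  exact : Function.Exact incl proj
  proj_surjective : Function.Surjective proj

/-- `add 𝒫`: the direct summands of finite direct sums of objects of `𝒫`. -/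
def addClosure {Q : Type u} [CommRing Q] (P : ObjectProperty (ModuleCat.{u} Q)) :
    ObjectProperty (ModuleCat.{u} Q) := fun N =>
  ∃ (r : ℕ) (X : Fin r → ModuleCat.{u} Q) (N' : ModuleCat.{u} Q),
    (∀ i, P (X i)) ∧ Nonempty ((N × N') ≃ₗ[Q] (∀ i, X i))

/-- The modules `Ω_Q(M)`, where `M` is an MCM module over `Q/(y^k)`, regarded as a `Q`-module. -/
def syzygiesOfMCM (Q : Type u) [CommRing Q] (y : Q) (k : ℕ) :
    ObjectProperty (ModuleCat.{u} Q) := fun N =>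
  ∃ M : ModuleCat.{u} (Q ⧸ Ideal.span {y ^ k}), IsMCM (Q ⧸ Ideal.span {y ^ k}) M ∧
    Nonempty (SyzygySequence Q N
      ((ModuleCat.restrictScalars (Ideal.Quotient.mk (Ideal.span {y ^ k}))).obj M))

/-- `Σ_k = add {Ω_Q(M) | M an MCM module over Q/(y^k)}`, a class of `Q`-modules. -/
def Sigma (Q : Type u) [CommRing Q] (y : Q) (k : ℕ) : ObjectProperty (ModuleCat.{u} Q) :=
  addClosure (syzygiesOfMCM Q y k)

/-! ### The stable category -/

/-- The category `MCM(Q)`. -/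
abbrev MCM (Q : Type u) [CommRing Q] := (IsMCM Q).FullSubcategory

/-- Two morphisms of MCM modules are identified in the stable category when their difference
factors through a free module of finite rank. -/
def stableRel (Q : Type u) [CommRing Q] : HomRel (MCM Q) := fun X Y f g =>
  ∃ (r : ℕ) (a : X.obj ⟶ ModuleCat.of Q (Fin r → Q)) (b : ModuleCat.of Q (Fin r → Q) ⟶ Y.obj),
    f.hom - g.hom = a ≫ b

/-- The relation is a congruence, so that morphisms in the quotient category are exactly the
morphisms of MCM modules modulo those that factor through a free module. -/
instance (Q : Type u) [CommRing Q] : Congruence (stableRel Q) where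
  equivalence := by
    intro X Y
    refine ⟨fun f => ⟨0, 0, 0, by simp⟩, ?_, ?_⟩
    · rintro f g ⟨r, a, b, h⟩
      exact ⟨r, -a, b, by rw [Preadditive.neg_comp, ← h, neg_sub]⟩
    · rintro f g k ⟨r, a, b, h⟩ ⟨s, c, d, h'⟩
      let e : ModuleCat.of Q (Fin (r + s) → Q) ≅
          ModuleCat.of Q ((Fin r → Q) × (Fin s → Q)) :=
        (((LinearEquiv.funCongrLeft Q Q finSumFinEquiv).trans
          (LinearEquiv.sumArrowLequivProdArrow (Fin r) (Fin s) Q Q))).toModuleIso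
      refine ⟨r + s, ModuleCat.ofHom (a.hom.prod c.hom) ≫ e.inv,
        e.hom ≫ ModuleCat.ofHom (b.hom.coprod d.hom), ?_⟩
      rw [Category.assoc, e.inv_hom_id_assoc, ← sub_add_sub_cancel f.hom g.hom k.hom, h, h']
      ext x
      simp
  comp_left := by
    rintro X Y Z f g g' ⟨r, a, b, h⟩
    exact ⟨r, f.hom ≫ a, b, by simp [← h]⟩
  comp_right := by
    rintro X Y Z f f' g ⟨r, a, b, h⟩
    exact ⟨r, a, b ≫ g.hom, by rw [← Category.assoc, ← h]; simp⟩

/-- The stable category of MCM modules over `Q`. -/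
abbrev StableMCM (Q : Type u) [CommRing Q] := CategoryTheory.Quotient (stableRel Q)

/-- The projection functor from MCM modules to the stable category. -/
abbrev toStable (Q : Type u) [CommRing Q] : MCM Q ⥤ StableMCM Q :=
  CategoryTheory.Quotient.functor (stableRel Q)

/-- The distinguished triangles `X → Y → Z → X[1]` of the stable category, where the suspension
`X[1]` is represented by a cosyzygy `X'` of `X` through the exact sequence
`s : 0 → X → F → X' → 0`. The standard triangle on a homomorphism `f : X → Y` is
`X → Y → C → X'`, where `C` is the pushout of `X → F` along `f`, `j : Y → C` is the structure map,
and `q : C → X'` is induced by `F → X'` and by `0` on `Y`; the distinguished triangles are those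
isomorphic to a standard one. -/
def IsDistinguished {Q : Type u} [CommRing Q] {X Y Z X' : StableMCM Q}
    (s : SyzygySequence Q X.as.obj X'.as.obj) (a : X ⟶ Y) (b : Y ⟶ Z) (c : Z ⟶ X') : Prop :=
  ∃ (f : X.as ⟶ Y.as) (C : MCM Q) (j : Y.as ⟶ C)
    (l : ModuleCat.of Q (Fin s.rank → Q) ⟶ C.obj) (q : C ⟶ X'.as)
    (e : Z ≅ (toStable Q).obj C),
    IsPushout f.hom s.incl j.hom l ∧ j.hom ≫ q.hom = 0 ∧ l ≫ q.hom = s.proj ∧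
    (toStable Q).map f = a ∧ b ≫ e.hom = (toStable Q).map j ∧ e.hom ≫ (toStable Q).map q = c

/-- Closed under isomorphisms, direct summands, finite direct sums and shifts in both directions.
(In the additive category of stable MCM modules finite direct sums are finite products; `X'` is the
suspension `X[1]`, and `X` is `X'[-1]`, whenever there is an exact sequence `0 → X → F → X' → 0`
with `F` free.) -/
structure IsClosed {Q : Type u} [CommRing Q] (P : ObjectProperty (StableMCM Q)) : Prop where
  iso : P.IsClosedUnderIsomorphisms
  summands : P.IsStableUnderRetracts
  sums : P.IsClosedUnderFiniteProducts
  shifts : ∀ X X' : StableMCM Q, Nonempty (SyzygySequence Q X.as.obj X'.as.obj) → (P X ↔ P X')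

/-- `⟨I⟩`: the smallest full subcategory that contains `I` and is closed under isomorphisms,
direct summands, finite direct sums and shifts. -/
def gen {Q : Type u} [CommRing Q] (I : ObjectProperty (StableMCM Q)) :
    ObjectProperty (StableMCM Q) := fun X =>
  ∀ P : ObjectProperty (StableMCM Q), IsClosed P → I ≤ P → P X

/-- `I * J`: the objects `Y` in a distinguished triangle `X₁ → Y → X₂ → X₁[1]` with `X₁` in `I`
and `X₂` in `J`. -/
def star {Q : Type u} [CommRing Q] (I J : ObjectProperty (StableMCM Q)) :
    ObjectProperty (StableMCM Q) := fun Y =>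
  ∃ (X₁ X₂ X₁' : StableMCM Q) (s : SyzygySequence Q X₁.as.obj X₁'.as.obj)
    (a : X₁ ⟶ Y) (b : Y ⟶ X₂) (c : X₂ ⟶ X₁'), I X₁ ∧ J X₂ ∧ IsDistinguished s a b c

/-- `I ⋄ J = ⟨I * J⟩`. -/
def diamond {Q : Type u} [CommRing Q] (I J : ObjectProperty (StableMCM Q)) :
    ObjectProperty (StableMCM Q) :=
  gen (star I J)

/-- `⟨I⟩_0 = ⟨I⟩` and `⟨I⟩_{m+1} = ⟨I⟩_m ⋄ ⟨I⟩`. -/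
def genIter {Q : Type u} [CommRing Q] (I : ObjectProperty (StableMCM Q)) :
    ℕ → ObjectProperty (StableMCM Q)
  | 0 => gen I
  | m + 1 => diamond (genIter I m) (gen I)

/-- The image of `Σ_k` in the stable category (closed under isomorphisms). -/
def stableSigma (Q : Type u) [CommRing Q] (y : Q) (k : ℕ) : ObjectProperty (StableMCM Q) :=
  ((Sigma Q y k).inverseImage (IsMCM Q).ι).map (toStable Q)

/-! ### The branched cover -/

/-- The `n`-fold branched cover `R^# = S[y]/(f + y^n)`. -/
abbrev Cover {S : Type u} [CommRing S] (f : S) (n : ℕ) : Type u :=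
  AdjoinRoot (C f + X ^ n : S[X])

/-- The class of `y` in `R^# = S[y]/(f + y^n)`. -/
noncomputable abbrev Cover.y {S : Type u} [CommRing S] (f : S) (n : ℕ) : Cover f n :=
  AdjoinRoot.root (C f + X ^ n : S[X])

end BranchedCover

namespace BranchedCover

open IsLocalRing RingTheory.Sequence CategoryTheory.Abelian
open scoped Pointwise

/-! ### Depth through `Ext` -/

/-! Write `Q` for the branched cover. The proof replaces `Σ_k` by an annihilator condition: `Σ_k`
consists of the MCM modules on which multiplication by `y ^ k` factors through a finite free module
(`StablyKills`, `sigma_iff`). If `N ⊆ F` is a syzygy of a module killed by `y ^ k`, then `y ^ k F ⊆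
N`, so `y ^ k` on `N` factors through `F`. Conversely, `y` is regular on an MCM module `X`; a
factorization of `y ^ k` through a free module lifts along a free cover `G → X`, lands in the kernel
of `G → X / y ^ k X`, and makes `X` a retract of that kernel (`exists_retract_ker`).

For (1), annihilators multiply along triangles (`stablyZero_of_isDistinguished`), and being stably
annihilated by a fixed element is closed under all the operations defining `gen`
(`isClosed_stablyZero`). In the other direction, cover `X` redundantly by `(u, w) ↦ π u + y ^ j • π
w`. The kernel of the induced map to `X / y ^ k X` is an extension of a syzygy of `X / y ^ j X` by a
syzygy of `X / y ^ (k - j) X`, and it has `X` as a retract (`exists_extension_retract`).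

For (2), `Q` is free over `S` on `1, y, …, y ^ (n - 1)`, and the top coefficient is a Frobenius
form, so `Q`-linear maps `X → Q` correspond to `S`-linear maps `X → S`. An `S`-basis of `X` then
gives maps `X → Q ^ m → X` whose composite is `n y ^ (n - 1)`, the derivative of `f + y ^ n` in `y`
(`exists_embedding`). If `n` is a unit, `y ^ (n - 1)` is stably zero on every MCM module; iterating
(1) gives the last equality.

All of this rests on identifying MCM `Q`-modules with the finitely generated ones that are
projective over `S` (`isMCM_iff_isLattice`), which uses depth via `Ext` and the freeness of MCM
modules over a regular local ring. The same Frobenius form makes `Q` injective relative to lattice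
cokernels (`exists_extension`), as needed for cosyzygies and triangles. -/

/-- `Extⁱ(k, M) = 0` for all `i < e`, where `k` is the residue field of `R`. -/
def DepthGE (R : Type u) [CommRing R] [IsLocalRing R] (e : ℕ) (M : ModuleCat.{u} R) : Prop :=
  ∀ i < e, Subsingleton (Ext (ModuleCat.of R (ResidueField R)) M i)

section Depth

variable {R : Type u} [CommRing R] [IsLocalRing R]

lemma support_residueField :
    Module.support R (ResidueField R) = PrimeSpectrum.zeroLocus (maximalIdeal R : Set R) := by
  have : Module.Finite R (ResidueField R) :=
    Module.Finite.of_surjective (Algebra.linearMap R (ResidueField R)) residue_surjective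
  rw [Module.support_eq_zeroLocus]
  congr 2
  exact Ideal.annihilator_quotient

lemma smul_top_lt_top (M : Type u) [AddCommGroup M] [Module R M] [Module.Finite R M]
    [Nontrivial M] : maximalIdeal R • (⊤ : Submodule R M) < ⊤ :=
  (Submodule.top_ne_ideal_smul_of_le_jacobson_annihilator (maximalIdeal_le_jacobson _)).symm.lt_top

/-- Rees: depth is measured by regular sequences in the maximal ideal. -/
lemma depthGE_iff_exists_isRegular [IsNoetherianRing R] (e : ℕ) (M : ModuleCat.{u} R)
    [Module.Finite R M] [Nontrivial M] : DepthGE R e M ↔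
      ∃ rs : List R, rs.length = e ∧ (∀ r ∈ rs, r ∈ maximalIdeal R) ∧ IsRegular M rs := by
  have hfin : Module.Finite R (ResidueField R) :=
    Module.Finite.of_surjective (Algebra.linearMap R (ResidueField R)) residue_surjective
  constructor
  · intro h
    exact ModuleCat.exists_isRegular_of_exists_subsingleton_ext (maximalIdeal R) e M
      (smul_top_lt_top M) (ModuleCat.of R (ResidueField R)) support_residueField h
  · rintro ⟨rs, rfl, hmem, hreg⟩
    exact ModuleCat.subsingleton_ext_of_exists_isRegular (maximalIdeal R)
      (ModuleCat.of R (ResidueField R)) support_residueField.subset M (smul_top_lt_top M) rs hmem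
      hreg

lemma DepthGE.of_subsingleton (e : ℕ) (M : ModuleCat.{u} R) [Subsingleton M] : DepthGE R e M := by
  intro i _
  have hM : IsZero M := ModuleCat.isZero_of_subsingleton M
  refine ⟨fun a b => ?_⟩
  rw [← Ext.comp_mk₀_id a, ← Ext.comp_mk₀_id b, hM.eq_of_src (𝟙 M) 0]
  simp

/-- Depth of the cokernel in a short exact sequence. -/
lemma DepthGE.cokernel {T : ShortComplex (ModuleCat.{u} R)} (hT : T.ShortExact) {e : ℕ}
    (h₁ : DepthGE R (e + 1) T.X₁) (h₂ : DepthGE R e T.X₂) : DepthGE R e T.X₃ := by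
  intro i hi
  have zero1 := AddCommGrpCat.isZero_of_iff_subsingleton.mpr (h₂ i hi)
  have zero2 := AddCommGrpCat.isZero_of_iff_subsingleton.mpr (h₁ (i + 1) (by omega))
  exact AddCommGrpCat.subsingleton_of_isZero <| ShortComplex.Exact.isZero_of_both_zeros
    ((Ext.covariant_sequence_exact₃' _ hT) i (i + 1) rfl)
    (zero1.eq_zero_of_src _) (zero2.eq_zero_of_tgt _)

/-- Depth of the kernel in a short exact sequence. -/
lemma DepthGE.kernel {T : ShortComplex (ModuleCat.{u} R)} (hT : T.ShortExact) {e : ℕ}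
    (h₂ : DepthGE R (e + 1) T.X₂) (h₃ : DepthGE R e T.X₃) : DepthGE R (e + 1) T.X₁ := by
  intro i hi
  have zero2 := AddCommGrpCat.isZero_of_iff_subsingleton.mpr (h₂ i hi)
  cases i with
  | zero =>
    have hm : Mono T.f := hT.mono_f
    have := Ext.postcomp_mk₀_injective_of_mono (ModuleCat.of R (ResidueField R)) T.f
    have h := h₂ 0 hi
    exact this.subsingleton
  | succ i =>
    have zero1 := AddCommGrpCat.isZero_of_iff_subsingleton.mpr (h₃ i (by omega))
    exact AddCommGrpCat.subsingleton_of_isZero <| ShortComplex.Exact.isZero_of_both_zeros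
      ((Ext.covariant_sequence_exact₁' _ hT) i (i + 1) rfl)
      (zero1.eq_zero_of_src _) (zero2.eq_zero_of_tgt _)

lemma DepthGE.quotSMulTop {e : ℕ} {M : ModuleCat.{u} R} (h : DepthGE R (e + 1) M) {x : R}
    (hx : IsSMulRegular M x) : DepthGE R e (ModuleCat.of R (QuotSMulTop x M)) :=
  DepthGE.cokernel hx.smulShortComplex_shortExact h fun i hi => h i (by omega)

end Depth

/-! ### Regular local rings -/

section Regular

/-- Prime avoidance tolerates the non-prime ideal `𝔪 ^ 2`, and Nakayama excludes `𝔪 ⊆ 𝔪 ^ 2`. It is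
applied to minimal primes and to associated primes. -/
lemma exists_mem_notMem_sq_notMem_primes {R : Type u} [CommRing R] [IsLocalRing R]
    [IsNoetherianRing R] (hR : maximalIdeal R ≠ ⊥) {T : Set (Ideal R)} (hT : T.Finite)
    (hp : ∀ p ∈ T, p.IsPrime) (hm : ∀ p ∈ T, p ≠ maximalIdeal R) :
    ∃ x ∈ maximalIdeal R, x ∉ maximalIdeal R ^ 2 ∧ ∀ p ∈ T, x ∉ p := by
  by_contra! hcon
  have key := (Ideal.subset_union_prime_finite (hT.insert (maximalIdeal R ^ 2)) (f := id)
    (maximalIdeal R ^ 2) (maximalIdeal R ^ 2)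
    (by
      rintro i (rfl | hi) h _
      · exact absurd rfl h
      · exact hp i hi) (I := maximalIdeal R)).mp (by
    intro x hx
    simp only [Set.mem_iUnion]
    by_cases h2 : x ∈ maximalIdeal R ^ 2
    · exact ⟨_, Set.mem_insert _ _, h2⟩
    · obtain ⟨p, hpT, hxp⟩ := hcon x hx h2
      exact ⟨p, Set.mem_insert_of_mem _ hpT, hxp⟩)
  obtain ⟨i, hi | hi, hle⟩ := key
  · subst hi
    apply hR
    apply Submodule.eq_bot_of_le_smul_of_le_jacobson_bot (maximalIdeal R) _
      (maximalIdeal R).fg_of_isNoetherianRing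
    · simpa [pow_two] using hle
    · exact maximalIdeal_le_jacobson _
  · have := (hp i hi).ne_top
    exact hm i hi (((maximalIdeal.isMaximal R).eq_of_le this hle).symm)

lemma isLocalRing_quotient_span_singleton {R : Type u} [CommRing R] [IsLocalRing R] {x : R}
    (hx : x ∈ maximalIdeal R) : IsLocalRing (R ⧸ Ideal.span {x}) := by
  have : Nontrivial (R ⧸ Ideal.span {x}) := Ideal.Quotient.nontrivial_iff.mpr fun h => by
    rw [Ideal.span_singleton_eq_top] at h
    exact hx h
  exact IsLocalRing.of_surjective' (Ideal.Quotient.mk _) Ideal.Quotient.mk_surjective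

/-- Since `x ∉ 𝔪 ^ 2`, some coefficient of `x` in a minimal generating set is a unit; that generator
becomes redundant modulo `x`. -/
lemma spanFinrank_maximalIdeal_quotient_succ_le {R : Type u} [CommRing R] [IsLocalRing R]
    [IsNoetherianRing R] {x : R} (hx : x ∈ maximalIdeal R) (hx2 : x ∉ maximalIdeal R ^ 2)
    [IsLocalRing (R ⧸ Ideal.span {x})] :
    (maximalIdeal (R ⧸ Ideal.span {x})).spanFinrank + 1 ≤ (maximalIdeal R).spanFinrank := by
  classical
  obtain ⟨s, hcard, hs⟩ :=
    Submodule.FG.exists_span_finset_card_eq_spanFinrank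
      (maximalIdeal R).fg_of_isNoetherianRing
  have hxs : x ∈ Submodule.span R (s : Set R) := by rw [hs]; exact hx
  obtain ⟨a, -, ha⟩ := Submodule.mem_span_finset.mp hxs
  obtain ⟨w, hw, hunit⟩ : ∃ w ∈ s, IsUnit (a w) := by
    by_contra! hcon
    apply hx2
    rw [← ha, pow_two]
    refine Ideal.sum_mem _ fun w hw => Ideal.mul_mem_mul (hcon w hw) ?_
    rw [← hs]
    exact Submodule.subset_span hw
  have hmax : maximalIdeal (R ⧸ Ideal.span {x}) =
      Submodule.span (R ⧸ Ideal.span {x})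
        (((s.erase w).image (Ideal.Quotient.mk (Ideal.span {x})) : Finset _) : Set _) := by
    rw [← map_maximalIdeal_of_surjective (Ideal.Quotient.mk (Ideal.span {x}))
      Ideal.Quotient.mk_surjective, ← hs]
    change Ideal.map _ (Ideal.span _) = _
    rw [Ideal.map_span]
    apply le_antisymm
    · rw [Ideal.span_le]
      rintro _ ⟨v, hv, rfl⟩
      by_cases hvw : v = w
      · subst hvw
        have h0 : Ideal.Quotient.mk (Ideal.span {x}) (∑ i ∈ s, a i • i) = 0 := by
          rw [ha, Ideal.Quotient.eq_zero_iff_mem]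
          exact Ideal.mem_span_singleton_self x
        rw [← Finset.add_sum_erase _ _ hv, map_add] at h0
        simp only [smul_eq_mul, map_mul, map_sum] at h0
        have hu := hunit.map (Ideal.Quotient.mk (Ideal.span {x}))
        have : Ideal.Quotient.mk (Ideal.span {x}) (a v) * Ideal.Quotient.mk (Ideal.span {x}) v ∈
            Submodule.span (R ⧸ Ideal.span {x})
              (((s.erase v).image (Ideal.Quotient.mk (Ideal.span {x})) : Finset _) : Set _) := by
          rw [eq_neg_of_add_eq_zero_left h0]
          refine neg_mem (Submodule.sum_mem _ fun i hi => ?_)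
          exact Submodule.smul_mem _ _ (Submodule.subset_span
            (by rw [Finset.coe_image]; exact ⟨i, hi, rfl⟩))
        exact (Ideal.unit_mul_mem_iff_mem _ hu).mp this
      · exact Submodule.subset_span (by
          rw [Finset.coe_image]; exact ⟨v, Finset.mem_erase.mpr ⟨hvw, hv⟩, rfl⟩)
    · apply Submodule.span_mono
      rw [Finset.coe_image]
      exact Set.image_mono (by exact_mod_cast s.erase_subset w)
  have h1 : (maximalIdeal (R ⧸ Ideal.span {x})).spanFinrank ≤ (s.erase w).card := by
    rw [hmax]
    refine (Submodule.spanFinrank_span_le_ncard_of_finite (Finset.finite_toSet _)).trans ?_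
    rw [Set.ncard_coe_finset]
    exact Finset.card_image_le
  rw [Finset.card_erase_of_mem hw] at h1
  have : 0 < s.card := Finset.card_pos.mpr ⟨w, hw⟩
  omega

/-- The embedding dimension drops by at least one and the Krull dimension by at most one; as the
former bounds the latter, both drop by exactly one. -/
lemma isRegularLocalRing_quotient {R : Type u} [CommRing R] [IsRegularLocalRing R] {x : R}
    (hx : x ∈ maximalIdeal R) (hx2 : x ∉ maximalIdeal R ^ 2)
    [IsLocalRing (R ⧸ Ideal.span {x})] :
    IsRegularLocalRing (R ⧸ Ideal.span {x}) ∧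
      (maximalIdeal (R ⧸ Ideal.span {x})).spanFinrank + 1 = (maximalIdeal R).spanFinrank := by
  have h1 := spanFinrank_maximalIdeal_quotient_succ_le hx hx2
  have h2 := ringKrullDim_le_ringKrullDim_quotient_add_card (R := R) {x}
    (by rw [IsLocalRing.ringJacobson_eq_maximalIdeal]; simpa using hx)
  rw [Finset.coe_singleton, Finset.card_singleton,
    ← IsRegularLocalRing.spanFinrank_maximalIdeal] at h2
  have h3 := ringKrullDim_le_spanFinrank_maximalIdeal (R ⧸ Ideal.span {x})
  have h4 : ((maximalIdeal (R ⧸ Ideal.span {x})).spanFinrank + 1 : WithBot ℕ∞) ≤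
      (maximalIdeal R).spanFinrank := by exact_mod_cast h1
  have h5 : ((maximalIdeal (R ⧸ Ideal.span {x})).spanFinrank + 1 : WithBot ℕ∞) ≤
      ringKrullDim (R ⧸ Ideal.span {x}) + 1 := h4.trans (by simpa using h2)
  have h6 : ((maximalIdeal (R ⧸ Ideal.span {x})).spanFinrank : WithBot ℕ∞) ≤
      ringKrullDim (R ⧸ Ideal.span {x}) := by
    rwa [← Nat.cast_one, ENat.WithBot.add_le_add_natCast_right_iff] at h5
  refine ⟨IsRegularLocalRing.of_spanFinrank_maximalIdeal_le _ h6, le_antisymm h1 ?_⟩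
  have h7 : ((maximalIdeal R).spanFinrank : WithBot ℕ∞) ≤
      (maximalIdeal (R ⧸ Ideal.span {x})).spanFinrank + 1 :=
    h2.trans (by simpa using add_le_add_left h3 1)
  exact_mod_cast h7

/-- A regular local ring of dimension `d` is a domain whose maximal ideal is generated by a regular
sequence of length `d`. -/
lemma isDomain_and_exists_isRegular (d : ℕ) : ∀ (R : Type u) [CommRing R] [IsRegularLocalRing R],
    (maximalIdeal R).spanFinrank = d → IsDomain R ∧
      ∃ rs : List R, rs.length = d ∧ Ideal.ofList rs = maximalIdeal R ∧ IsRegular R rs := by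
  induction d with
  | zero =>
    intro R _ _ h
    have hbot : maximalIdeal R = ⊥ :=
      (Submodule.spanFinrank_eq_zero_iff_eq_bot (maximalIdeal R).fg_of_isNoetherianRing).mp h
    have hf := isField_iff_maximalIdeal_eq.mpr hbot
    exact ⟨hf.isDomain, [], rfl, by simp [hbot], IsRegular.nil R R⟩
  | succ d ih =>
    intro R _ _ h
    have hbot : maximalIdeal R ≠ ⊥ := fun hb => by
      rw [hb, Submodule.spanFinrank_bot] at h
      omega
    -- The maximal ideal is not a minimal prime because the dimension is positive.
    obtain ⟨x, hx, hx2, hxp⟩ := exists_mem_notMem_sq_notMem_primes hbot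
      (minimalPrimes.finite_of_isNoetherianRing R) (fun p hp => hp.1.1) (fun p hp hpm => by
        have h1 : (maximalIdeal R).height = 0 := by
          rw [← hpm]
          have := hp.1.1
          exact (Ideal.height_eq_zero_iff).mpr hp
        have h2 := maximalIdeal_height_eq_ringKrullDim (R := R)
        rw [h1, ← IsRegularLocalRing.spanFinrank_maximalIdeal, h] at h2
        have : (0 : WithBot ℕ∞) = ((d + 1 : ℕ) : WithBot ℕ∞) := h2
        exact absurd (Nat.cast_injective (R := WithBot ℕ∞) (by simpa using this))
          (Nat.succ_ne_zero d).symm)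
    have := isLocalRing_quotient_span_singleton hx
    obtain ⟨hreg, hdim⟩ := isRegularLocalRing_quotient hx hx2
    obtain ⟨hdom, rs, hlen, hspan, hrs⟩ := ih (R ⧸ Ideal.span {x}) (by omega)
    have hprime : (Ideal.span {x}).IsPrime := Ideal.Quotient.isDomain_iff_prime _ |>.mp hdom
    have hR : IsDomain R := by
      obtain ⟨p, hp, hpx⟩ := Ideal.exists_minimalPrimes_le (I := ⊥) (J := Ideal.span {x}) bot_le
      have hpp : p.IsPrime := hp.1.1
      -- As `p ⊆ (x)` is prime and `x ∉ p`, each element of `p` is `x` times an element of `p`;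
      -- Nakayama gives `p = 0`.
      have hpbot : p = ⊥ := by
        apply Submodule.eq_bot_of_le_smul_of_le_jacobson_bot (maximalIdeal R) _
          p.fg_of_isNoetherianRing _ (maximalIdeal_le_jacobson _)
        intro z hz
        obtain ⟨c, rfl⟩ := Ideal.mem_span_singleton'.mp (hpx hz)
        rw [mul_comm]
        exact Submodule.smul_mem_smul hx ((hpp.mem_or_mem hz).resolve_right (hxp p hp))
      rw [hpbot] at hpp
      have := (Ideal.Quotient.isDomain_iff_prime (⊥ : Ideal R)).mpr hpp
      exact (RingEquiv.quotientBot R).symm.toMulEquiv.isDomain _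
    refine ⟨hR, ?_⟩
    have hx0 : x ≠ 0 := fun h0 => hx2 (h0 ▸ zero_mem _)
    choose g hg using Ideal.Quotient.mk_surjective (I := Ideal.span {x})
    have hmap : (rs.map g).map (Ideal.Quotient.mk (Ideal.span {x})) = rs := by
      rw [List.map_map]
      conv_rhs => rw [← List.map_id rs]
      exact List.map_congr_left fun a _ => hg a
    refine ⟨x :: rs.map g, by simp [hlen], ?_, ?_⟩
    · have h1 : Ideal.map (Ideal.Quotient.mk (Ideal.span {x})) (Ideal.ofList (rs.map g)) =
          Ideal.map (Ideal.Quotient.mk (Ideal.span {x})) (maximalIdeal R) := by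
        rw [Ideal.map_ofList, hmap, hspan,
          map_maximalIdeal_of_surjective _ Ideal.Quotient.mk_surjective]
      rw [Ideal.ofList_cons]
      have h2 := congrArg (Ideal.comap (Ideal.Quotient.mk (Ideal.span {x}))) h1
      rw [Ideal.comap_map_of_surjective' _ Ideal.Quotient.mk_surjective,
        Ideal.comap_map_of_surjective' _ Ideal.Quotient.mk_surjective, Ideal.mk_ker] at h2
      rw [sup_comm, h2, sup_eq_left]
      exact (Ideal.span_singleton_le_iff_mem _).mpr hx
    · rw [isRegular_cons_iff']
      refine ⟨fun a b hab => mul_left_cancel₀ hx0 hab, ?_⟩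
      rw [hmap]
      have hq : (Ideal.span {x}) = x • (⊤ : Ideal R) := by
        rw [← Submodule.ideal_span_singleton_smul]; simp
      let e : (R ⧸ Ideal.span {x}) ≃ₗ[R ⧸ Ideal.span {x}] QuotSMulTop x R :=
        (Submodule.quotEquivOfEq _ _ hq).extendScalarsOfSurjective Ideal.Quotient.mk_surjective
      exact (e.isRegular_congr rs).mp hrs

/-- A maximal Cohen-Macaulay module over a regular local ring is free. -/
lemma free_of_isRegular (d : ℕ) : ∀ (R : Type u) [CommRing R] [IsRegularLocalRing R]
    (M : Type u) [AddCommGroup M] [Module R M] [Module.Finite R M] (rs : List R),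
    (maximalIdeal R).spanFinrank = d → rs.length = d → (∀ r ∈ rs, r ∈ maximalIdeal R) →
    IsRegular M rs → Module.Free R M := by
  induction d with
  | zero =>
    intro R _ _ M _ _ _ rs h _ _ _
    have hbot : maximalIdeal R = ⊥ :=
      (Submodule.spanFinrank_eq_zero_iff_eq_bot (maximalIdeal R).fg_of_isNoetherianRing).mp h
    have hf := isField_iff_maximalIdeal_eq.mpr hbot
    let := hf.toField
    exact Module.Free.of_divisionRing R M
  | succ d ih =>
    intro R _ _ M _ _ _ rs h hlen hmem hrs
    have : Nontrivial M := hrs.nontrivial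
    have hdepth : DepthGE R (d + 1) (ModuleCat.of R M) :=
      (depthGE_iff_exists_isRegular _ (ModuleCat.of R M)).mpr ⟨rs, hlen, hmem, hrs⟩
    have hbot : maximalIdeal R ≠ ⊥ := fun hb => by
      rw [hb, Submodule.spanFinrank_bot] at h
      omega
    -- The maximal ideal is not associated to `M`, since it contains the first term of `rs`, which
    -- is regular on `M`. Avoiding the associated primes makes `x` regular on `M`.
    obtain ⟨x, hx, hx2, hxp⟩ := exists_mem_notMem_sq_notMem_primes hbot
      (associatedPrimes.finite R M) (fun p hp => hp.isPrime) (fun p hp hpm => by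
        obtain _ | ⟨r, rs⟩ := rs
        · simp at hlen
        · have h1 := ((isRegular_cons_iff M r rs).mp hrs).1
          have h2 : r ∈ ⋃ p ∈ associatedPrimes R M, (p : Set R) := by
            simp only [Set.mem_iUnion]
            exact ⟨p, hp, by rw [hpm]; exact hmem r List.mem_cons_self⟩
          rw [biUnion_associatedPrimes_eq_compl_regular] at h2
          exact h2 h1)
    have hxreg : IsSMulRegular M x := by
      by_contra hcon
      have h2 : x ∈ ⋃ p ∈ associatedPrimes R M, (p : Set R) := by
        rw [biUnion_associatedPrimes_eq_compl_regular]
        exact hcon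
      simp only [Set.mem_iUnion] at h2
      obtain ⟨p, hp, hxp'⟩ := h2
      exact hxp p hp hxp'
    have := isLocalRing_quotient_span_singleton hx
    obtain ⟨hreg, hdim⟩ := isRegularLocalRing_quotient hx hx2
    have hnt := nontrivial_quotSMulTop_of_mem_maximalIdeal M hx
    obtain ⟨ts, htlen, htmem, hts⟩ := (depthGE_iff_exists_isRegular d
      (ModuleCat.of R (QuotSMulTop x M))).mp (DepthGE.quotSMulTop hdepth hxreg)
    have hfin : Module.Finite (R ⧸ Ideal.span {x}) (QuotSMulTop x M) :=
      Module.Finite.of_restrictScalars_finite R _ _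
    have hmem' : ∀ r ∈ ts.map (algebraMap R (R ⧸ Ideal.span {x})),
        r ∈ maximalIdeal (R ⧸ Ideal.span {x}) := by
      intro r hr
      obtain ⟨t, ht, rfl⟩ := List.mem_map.mp hr
      rw [← map_maximalIdeal_of_surjective (Ideal.Quotient.mk (Ideal.span {x}))
        Ideal.Quotient.mk_surjective]
      exact Ideal.mem_map_of_mem _ (htmem t ht)
    have hfree := ih (R ⧸ Ideal.span {x}) (QuotSMulTop x M)
      (ts.map (algebraMap R (R ⧸ Ideal.span {x}))) (by omega) (by simpa using htlen) hmem'
      (IsRegular.of_isWeaklyRegular_of_mem_maximalIdeal _ hmem'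
        ((isWeaklyRegular_map_algebraMap_iff _ _ _).mpr hts.1))
    have := Module.finitePresentation_of_finite R M
    exact (Module.free_quotSMulTop_iff_free R M (maximalIdeal_le_jacobson _ hx) hxreg).mp hfree

end Regular

end BranchedCover

namespace BranchedCover

open IsLocalRing RingTheory.Sequence CategoryTheory.Abelian
open scoped Pointwise

/-! ### Lattices over a finite algebra -/

/-- The finitely generated `Q`-modules that are projective over `S`. -/
def IsLattice (S : Type u) (Q : Type u) [CommRing S] [CommRing Q] [Algebra S Q] (X : Type u)
    [AddCommGroup X] [Module Q X] : Prop :=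
  Module.Finite Q X ∧ (let := Module.compHom X (algebraMap S Q); Module.Projective S X)

section Lattice

variable {S Q : Type u} [CommRing S] [CommRing Q] [Algebra S Q]

lemma isLattice_iff {X : Type u} [AddCommGroup X] [Module Q X] [Module S X] [IsScalarTower S Q X] :
    IsLattice S Q X ↔ Module.Finite Q X ∧ Module.Projective S X := by
  have h : ‹Module S X› = Module.compHom X (algebraMap S Q) :=
    Module.ext' _ _ fun s x => (algebraMap_smul Q s x).symm
  unfold IsLattice
  rw [h]

lemma IsLattice.equiv {X Y : Type u} [AddCommGroup X] [Module Q X] [AddCommGroup Y] [Module Q Y]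
    (hX : IsLattice S Q X) (e : X ≃ₗ[Q] Y) : IsLattice S Q Y := by
  let := Module.compHom X (algebraMap S Q)
  let := Module.compHom Y (algebraMap S Q)
  have : IsScalarTower S Q X := IsScalarTower.of_algebraMap_smul fun _ _ => rfl
  have : IsScalarTower S Q Y := IsScalarTower.of_algebraMap_smul fun _ _ => rfl
  obtain ⟨h1, h2⟩ := isLattice_iff.mp hX
  exact isLattice_iff.mpr ⟨Module.Finite.equiv e, Module.Projective.of_equiv (e.restrictScalars S)⟩

lemma IsLattice.of_prod {X Y : Type u} [AddCommGroup X] [Module Q X] [AddCommGroup Y] [Module Q Y]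
    (h : IsLattice S Q (X × Y)) : IsLattice S Q X := by
  let := Module.compHom X (algebraMap S Q)
  let := Module.compHom Y (algebraMap S Q)
  have : IsScalarTower S Q X := IsScalarTower.of_algebraMap_smul fun _ _ => rfl
  have : IsScalarTower S Q Y := IsScalarTower.of_algebraMap_smul fun _ _ => rfl
  obtain ⟨h1, h2⟩ := isLattice_iff.mp h
  exact isLattice_iff.mpr ⟨.of_surjective (LinearMap.fst Q X Y) LinearMap.fst_surjective,
    Module.Projective.of_split (LinearMap.inl S X Y) (LinearMap.fst S X Y) (by ext; rfl)⟩

lemma IsLattice.prod {X Y : Type u} [AddCommGroup X] [Module Q X] [AddCommGroup Y] [Module Q Y]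
    (hX : IsLattice S Q X) (hY : IsLattice S Q Y) : IsLattice S Q (X × Y) := by
  let := Module.compHom X (algebraMap S Q)
  let := Module.compHom Y (algebraMap S Q)
  have : IsScalarTower S Q X := IsScalarTower.of_algebraMap_smul fun _ _ => rfl
  have : IsScalarTower S Q Y := IsScalarTower.of_algebraMap_smul fun _ _ => rfl
  obtain ⟨h1, h2⟩ := isLattice_iff.mp hX
  obtain ⟨h3, h4⟩ := isLattice_iff.mp hY
  exact isLattice_iff.mpr ⟨inferInstance, inferInstance⟩

lemma IsLattice.pi {r : ℕ} {X : Fin r → Type u} [∀ i, AddCommGroup (X i)] [∀ i, Module Q (X i)]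
    (hX : ∀ i, IsLattice S Q (X i)) : IsLattice S Q (∀ i, X i) := by
  let inst : ∀ i, Module S (X i) := fun i => Module.compHom (X i) (algebraMap S Q)
  have (i : Fin r) : IsScalarTower S Q (X i) := IsScalarTower.of_algebraMap_smul fun _ _ => rfl
  have h1 (i : Fin r) : Module.Finite Q (X i) := (isLattice_iff.mp (hX i)).1
  have h2 (i : Fin r) : Module.Projective S (X i) := (isLattice_iff.mp (hX i)).2
  refine isLattice_iff.mpr ⟨inferInstance, ?_⟩
  exact Module.Projective.of_equiv (DirectSum.linearEquivFunOnFintype S (Fin r) X)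

lemma isLattice_free [Module.Projective S Q] (r : ℕ) : IsLattice S Q (Fin r → Q) :=
  IsLattice.pi fun _ => isLattice_iff.mpr ⟨inferInstance, inferInstance⟩

/-- Lattices are closed under extensions. -/
lemma IsLattice.of_exact [IsNoetherianRing Q] {A B D : Type u} [AddCommGroup A] [Module Q A]
    [AddCommGroup B] [Module Q B] [AddCommGroup D] [Module Q D] {i : A →ₗ[Q] B} {p : B →ₗ[Q] D}
    (hi : Function.Injective i) (hip : Function.Exact i p) (hp : Function.Surjective p)
    (hA : IsLattice S Q A) (hD : IsLattice S Q D) : IsLattice S Q B := by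
  let := Module.compHom A (algebraMap S Q)
  let := Module.compHom B (algebraMap S Q)
  let := Module.compHom D (algebraMap S Q)
  have : IsScalarTower S Q A := IsScalarTower.of_algebraMap_smul fun _ _ => rfl
  have : IsScalarTower S Q B := IsScalarTower.of_algebraMap_smul fun _ _ => rfl
  have : IsScalarTower S Q D := IsScalarTower.of_algebraMap_smul fun _ _ => rfl
  obtain ⟨h1, h2⟩ := isLattice_iff.mp hA
  obtain ⟨h3, h4⟩ := isLattice_iff.mp hD
  have hfin : Module.Finite Q B := by
    have := isNoetherian_of_range_eq_ker i p (LinearMap.exact_iff.mp hip).symm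
    infer_instance
  obtain ⟨σ, hσ⟩ := Module.projective_lifting_property (p.restrictScalars S) LinearMap.id hp
  refine isLattice_iff.mpr ⟨hfin, ?_⟩
  have hip' : Function.Exact (i.restrictScalars S) (p.restrictScalars S) := hip
  exact Module.Projective.of_equiv
    (hip'.splitSurjectiveEquiv hi ⟨σ, hσ⟩).1.symm

/-- The cokernel of an `S`-split inclusion of a lattice is a lattice. -/
lemma IsLattice.of_retraction {A B D : Type u} [AddCommGroup A] [Module Q A]
    [AddCommGroup B] [Module Q B] [AddCommGroup D] [Module Q D] {i : A →ₗ[Q] B} {p : B →ₗ[Q] D}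
    (hip : Function.Exact i p) (hp : Function.Surjective p) (hB : IsLattice S Q B)
    (ρ : B → A) (hadd : ∀ b b', ρ (b + b') = ρ b + ρ b')
    (hsmul : ∀ (s : S) b, ρ (algebraMap S Q s • b) = algebraMap S Q s • ρ b)
    (hρ : ∀ a, ρ (i a) = a) : IsLattice S Q D := by
  let := Module.compHom A (algebraMap S Q)
  let := Module.compHom B (algebraMap S Q)
  let := Module.compHom D (algebraMap S Q)
  have : IsScalarTower S Q A := IsScalarTower.of_algebraMap_smul fun _ _ => rfl
  have : IsScalarTower S Q B := IsScalarTower.of_algebraMap_smul fun _ _ => rfl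
  have : IsScalarTower S Q D := IsScalarTower.of_algebraMap_smul fun _ _ => rfl
  obtain ⟨h1, h2⟩ := isLattice_iff.mp hB
  refine isLattice_iff.mpr ⟨Module.Finite.of_surjective p hp, ?_⟩
  let ρ' : B →ₗ[S] A := ⟨⟨ρ, hadd⟩, hsmul⟩
  have hip' : Function.Exact (i.restrictScalars S) (p.restrictScalars S) := hip
  have hinj : Function.Injective (i.restrictScalars S) := Function.LeftInverse.injective hρ
  have hp' : Function.Surjective (p.restrictScalars S) := hp
  obtain ⟨s, hs⟩ := (hip'.splitSurjectiveEquiv hinj).symm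
    (hip'.splitInjectiveEquiv hp' ⟨ρ', LinearMap.ext hρ⟩)
  exact Module.Projective.of_split s _ hs

end Lattice

/-! ### Depth over a finite local algebra -/

/-- Vanishing of `Hom` from the residue field of `Q` yields a regular element in its maximal ideal.
A power of it lies in the extension of `maximalIdeal S`, so no nonzero element of `M` is killed by
`maximalIdeal S`, which therefore contains a regular element too. Divide by that element and induct.
-/
lemma exists_isWeaklyRegular_of_depthGE {S Q : Type u} [CommRing S] [CommRing Q] [Algebra S Q]
    [IsLocalRing S] [IsNoetherianRing S] [IsLocalRing Q] [IsNoetherianRing Q] [Module.Finite S Q]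
    (hrad : maximalIdeal Q ≤ ((maximalIdeal S).map (algebraMap S Q)).radical) (e : ℕ) :
    ∀ (M : Type u) [AddCommGroup M] [Module Q M] [Module.Finite Q M],
      DepthGE Q e (ModuleCat.of Q M) → ∃ rs : List S, rs.length = e ∧
        (∀ r ∈ rs, r ∈ maximalIdeal S) ∧ IsWeaklyRegular M (rs.map (algebraMap S Q)) := by
  induction e with
  | zero =>
    intro M _ _ _ _
    exact ⟨[], rfl, by simp, IsWeaklyRegular.nil Q M⟩
  | succ e ih =>
    intro M _ _ _ hM
    let := Module.compHom M (algebraMap S Q)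
    have : IsScalarTower S Q M := IsScalarTower.of_algebraMap_smul fun _ _ => rfl
    have hfin : Module.Finite S M := Module.Finite.trans Q M
    have : Module.Finite Q (ResidueField Q) :=
      Module.Finite.of_surjective (Algebra.linearMap Q (ResidueField Q)) residue_surjective
    have : Module.Finite S (ResidueField S) :=
      Module.Finite.of_surjective (Algebra.linearMap S (ResidueField S)) residue_surjective
    have hann (R : Type u) [CommRing R] [IsLocalRing R] :
        Module.annihilator R (ResidueField R) = maximalIdeal R := Ideal.annihilator_quotient
    have h0 := hM 0 (Nat.succ_pos e)
    have hsub : Subsingleton (ModuleCat.of Q (ResidueField Q) ⟶ ModuleCat.of Q M) :=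
      Ext.addEquiv₀.subsingleton_congr.mp h0
    have hsub' : Subsingleton (ResidueField Q →ₗ[Q] M) :=
      (ModuleCat.homAddEquiv (M := ModuleCat.of Q (ResidueField Q))
        (N := ModuleCat.of Q M)).symm.subsingleton
    obtain ⟨r, hr, hreg⟩ := IsSMulRegular.subsingleton_linearMap_iff.mp hsub'
    rw [hann] at hr
    have hker (x : M) (hx : ∀ s ∈ maximalIdeal S, s • x = 0) : x = 0 := by
      obtain ⟨N, hN⟩ := hrad hr
      have h1 : (maximalIdeal S).map (algebraMap S Q) ≤ Ideal.torsionOf Q M x := by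
        rw [Ideal.map_le_iff_le_comap]
        intro s hs
        simpa [Ideal.mem_torsionOf_iff] using hx s hs
      exact (hreg.pow N).right_eq_zero_of_smul ((Ideal.mem_torsionOf_iff _ _).mp (h1 hN))
    have hsubS : Subsingleton (ResidueField S →ₗ[S] M) := by
      refine subsingleton_of_forall_eq 0 fun g => LinearMap.ext fun x => hker _ fun s hs => ?_
      rw [← map_smul, Module.mem_annihilator.mp (by rwa [hann]) x, map_zero]
    obtain ⟨s, hs, hsreg⟩ := IsSMulRegular.subsingleton_linearMap_iff.mp hsubS
    rw [hann] at hs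
    have hsreg' : IsSMulRegular M (algebraMap S Q s) := hsreg
    obtain ⟨rs, hlen, hmem, hrs⟩ := ih (QuotSMulTop (algebraMap S Q s) M)
      (DepthGE.quotSMulTop (M := ModuleCat.of Q M) hM hsreg')
    refine ⟨s :: rs, by simp [hlen], by simpa using ⟨hs, hmem⟩, ?_⟩
    rw [List.map_cons, isWeaklyRegular_cons_iff]
    exact ⟨hsreg', hrs⟩

end BranchedCover

namespace BranchedCover

open IsLocalRing RingTheory.Sequence CategoryTheory.Abelian
open scoped Pointwise

/-! ### The branched cover as an algebra over the base -/

namespace Cover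

section Algebra

variable {S : Type u} [CommRing S] (f : S) {n : ℕ}

lemma monic (hn : n ≠ 0) : (C f + X ^ n : S[X]).Monic := by
  rw [add_comm]
  exact monic_X_pow_add_C f hn

lemma natDegree_eq [Nontrivial S] : (C f + X ^ n : S[X]).natDegree = n := by
  rw [add_comm]
  exact natDegree_X_pow_add_C

lemma y_pow : y f n ^ n = -algebraMap S (Cover f n) f := by
  have h := AdjoinRoot.mk_self (f := (C f + X ^ n : S[X]))
  rw [map_add, map_pow, AdjoinRoot.mk_X, AdjoinRoot.mk_C] at h
  rw [AdjoinRoot.algebraMap_eq]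
  exact eq_neg_of_add_eq_zero_right h

lemma exists_eq_sum [Nontrivial S] (hn : n ≠ 0) (q : Cover f n) :
    ∃ c : ℕ → S, q = ∑ i ∈ Finset.range n, c i • y f n ^ i := by
  obtain ⟨p, rfl⟩ := AdjoinRoot.mk_surjective q
  refine ⟨(p %ₘ (C f + X ^ n)).coeff, ?_⟩
  have h1 : (AdjoinRoot.mk (C f + X ^ n)) p = AdjoinRoot.mk (C f + X ^ n) (p %ₘ (C f + X ^ n)) := by
    rw [← AdjoinRoot.modByMonicHom_mk (monic f hn), AdjoinRoot.mk_leftInverse (monic f hn)]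
  have hdeg : (p %ₘ (C f + X ^ n)).natDegree < n := by
    have := natDegree_modByMonic_lt p (monic f hn) (fun h => by
      have := natDegree_eq f (n := n)
      rw [h, natDegree_one] at this
      exact hn this.symm)
    rwa [natDegree_eq] at this
  rw [h1]
  conv_lhs => rw [as_sum_range' _ n hdeg]
  rw [map_sum]
  refine Finset.sum_congr rfl fun i _ => ?_
  rw [← C_mul_X_pow_eq_monomial, map_mul, map_pow, AdjoinRoot.mk_X, AdjoinRoot.mk_C,
    ← AdjoinRoot.algebraMap_eq, Algebra.smul_def]

/-- The coefficient of `y ^ (n - 1)`. -/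
noncomputable def topCoeff (hn : n ≠ 0) : Cover f n →ₗ[S] S :=
  (lcoeff S (n - 1)).comp (AdjoinRoot.modByMonicHom (monic f hn))

lemma topCoeff_y_pow [Nontrivial S] (hn : n ≠ 0) {i : ℕ} (hi : i < n) :
    topCoeff f hn (y f n ^ i) = if i = n - 1 then 1 else 0 := by
  have h : y f n ^ i = AdjoinRoot.mk (C f + X ^ n) (X ^ i) := by
    rw [map_pow, AdjoinRoot.mk_X]
  rw [h, topCoeff, LinearMap.comp_apply, AdjoinRoot.modByMonicHom_mk,
    (modByMonic_eq_self_iff (monic f hn)).mpr, lcoeff_apply, coeff_X_pow]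
  · simp only [eq_comm]
  · rw [degree_X_pow, degree_eq_natDegree (monic f hn).ne_zero, natDegree_eq]
    exact_mod_cast hi

/-- Exponents from `n` to `2 n - 2` reduce, by `y ^ n = -f`, to multiples of powers below `y ^ (n -
1)`. -/
lemma topCoeff_y_pow_of_lt [Nontrivial S] (hn : n ≠ 0) {i : ℕ} (hi : i + 1 < 2 * n)
    (hi' : i ≠ n - 1) : topCoeff f hn (y f n ^ i) = 0 := by
  by_cases h : i < n
  · rw [topCoeff_y_pow f hn h, if_neg hi']
  · obtain ⟨m, rfl⟩ := Nat.exists_eq_add_of_le (not_lt.mp h)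
    rw [pow_add, y_pow, neg_mul, ← Algebra.smul_def, map_neg, map_smul,
      topCoeff_y_pow f hn (by omega), if_neg (by omega), smul_zero, neg_zero]

lemma nontrivial [Nontrivial S] (hn : n ≠ 0) : Nontrivial (Cover f n) := by
  refine ⟨⟨y f n ^ (n - 1), 0, fun h => ?_⟩⟩
  have := topCoeff_y_pow f hn (i := n - 1) (by omega)
  rw [h, map_zero, if_pos rfl] at this
  exact zero_ne_one this

end Algebra

/-! ### Frobenius duality between `Q`-linear and `S`-linear functionals -/

section Coextension

variable {S : Type u} [CommRing S] (f : S) {n : ℕ}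
variable {A : Type u} [AddCommGroup A] [Module (Cover f n) A] [Module S A]
  [IsScalarTower S (Cover f n) A]

/-- The two sums agree after an index shift, and the boundary terms match because both involve `y ^
n = -f`. This is the `y`-linearity of `coextend`. -/
lemma smul_sum_pow (hn : n ≠ 0) (ψ : A →ₗ[S] S) (x : A) :
    ∑ i ∈ Finset.range n, ψ (y f n ^ i • (y f n • x)) • y f n ^ (n - 1 - i) =
      y f n * ∑ i ∈ Finset.range n, ψ (y f n ^ i • x) • y f n ^ (n - 1 - i) := by
  obtain ⟨m, rfl⟩ := Nat.exists_eq_succ_of_ne_zero hn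
  rw [Finset.sum_range_succ, Finset.sum_range_succ', mul_add, Finset.mul_sum]
  have h1 : y f (m + 1) ^ m • y f (m + 1) • x = -(f • x) := by
    rw [smul_smul, ← pow_succ, y_pow, neg_smul, algebraMap_smul]
  have h2 : y f (m + 1) * (ψ (y f (m + 1) ^ 0 • x) • y f (m + 1) ^ (m + 1 - 1 - 0)) =
      ψ (-(f • x)) • 1 := by
    rw [mul_smul_comm, pow_zero, one_smul]
    simp only [Nat.add_sub_cancel, Nat.sub_zero]
    rw [← pow_succ', y_pow, map_neg, map_smul, Algebra.smul_def, Algebra.smul_def, map_neg,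
      smul_eq_mul, map_mul]
    ring
  congr 1
  · refine Finset.sum_congr rfl fun i hi => ?_
    have := Finset.mem_range.mp hi
    rw [mul_smul_comm, ← pow_succ', smul_smul, ← pow_succ]
    congr 2
    omega
  · rw [h1]
    rw [h2]
    simp

/-- The `Q`-linear map `A → Q` whose top coefficient is the given `S`-linear functional. -/
noncomputable def coextend (hn : n ≠ 0) (ψ : A →ₗ[S] S) : A →ₗ[Cover f n] Cover f n where
  toFun x := ∑ i ∈ Finset.range n, ψ (y f n ^ i • x) • y f n ^ (n - 1 - i)
  map_add' a b := by
    simp only [smul_add, map_add, add_smul, Finset.sum_add_distrib]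
  map_smul' q x := by
    simp only [RingHom.id_apply, smul_eq_mul]
    have hq : q ∈ Algebra.adjoin S {y f n} := by
      rw [AdjoinRoot.adjoinRoot_eq_top]
      trivial
    induction hq using Algebra.adjoin_induction generalizing x with
    | mem q hq =>
      rw [Set.mem_singleton_iff.mp hq]
      exact smul_sum_pow f hn ψ x
    | algebraMap s =>
      rw [Finset.mul_sum]
      refine Finset.sum_congr rfl fun i _ => ?_
      rw [algebraMap_smul, smul_comm, map_smul, smul_eq_mul, mul_smul, Algebra.smul_def s]
    | add a b _ _ ha hb =>
      simp only [add_smul, smul_add, map_add, Finset.sum_add_distrib, add_mul, ← ha, ← hb]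
    | mul a b _ _ ha hb =>
      rw [mul_assoc, ← hb, ← ha]
      simp only [mul_smul]

lemma coextend_apply (hn : n ≠ 0) (ψ : A →ₗ[S] S) (x : A) :
    coextend f hn ψ x = ∑ i ∈ Finset.range n, ψ (y f n ^ i • x) • y f n ^ (n - 1 - i) := rfl

lemma topCoeff_coextend [Nontrivial S] (hn : n ≠ 0) (ψ : A →ₗ[S] S) (x : A) :
    topCoeff f hn (coextend f hn ψ x) = ψ x := by
  rw [coextend_apply, map_sum, Finset.sum_eq_single 0]
  · rw [map_smul, Nat.sub_zero, topCoeff_y_pow f hn (by omega), if_pos rfl]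
    simp
  · intro i hi h0
    have := Finset.mem_range.mp hi
    rw [map_smul, topCoeff_y_pow f hn (by omega), if_neg (by omega), smul_zero]
  · intro h
    exact absurd (Finset.mem_range.mpr (by omega)) h

/-- The families `y ^ i` and `y ^ (n - 1 - i)` are dual bases for the form `(a, b) ↦ topCoeff (a
b)`. -/
lemma sum_topCoeff [Nontrivial S] (hn : n ≠ 0) (q : Cover f n) :
    ∑ i ∈ Finset.range n, topCoeff f hn (y f n ^ i * q) • y f n ^ (n - 1 - i) = q := by
  obtain ⟨c, rfl⟩ := exists_eq_sum f hn q
  simp only [Finset.mul_sum, map_sum, Finset.sum_smul, mul_smul_comm, map_smul, ← pow_add]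
  rw [Finset.sum_comm]
  refine Finset.sum_congr rfl fun j hj => ?_
  have hj := Finset.mem_range.mp hj
  rw [Finset.sum_eq_single (n - 1 - j)]
  · rw [topCoeff_y_pow f hn (by omega), if_pos (by omega), smul_eq_mul, mul_one]
    congr 2
    omega
  · intro i hi hij
    have := Finset.mem_range.mp hi
    rw [topCoeff_y_pow_of_lt f hn (by omega) (by omega)]
    simp
  · intro h
    exact absurd (Finset.mem_range.mpr (by omega)) h

/-- With `topCoeff_coextend`, this makes coextension and composition with `topCoeff` mutually
inverse. -/
lemma coextend_topCoeff_comp [Nontrivial S] (hn : n ≠ 0) (φ : A →ₗ[Cover f n] Cover f n) (x : A) :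
    coextend f hn ((topCoeff f hn).comp (φ.restrictScalars S)) x = φ x := by
  rw [coextend_apply]
  simp only [LinearMap.comp_apply, LinearMap.restrictScalars_apply, map_smul, smul_eq_mul]
  exact sum_topCoeff f hn (φ x)

end Coextension

/-! ### Relative injectivity of `Q` and the stable annihilator `n y ^ (n - 1)` -/

section Lattice

variable {S : Type u} [CommRing S] (f : S) {n : ℕ}

/-- Maps into a free module extend along an inclusion whose cokernel is a lattice. -/
lemma exists_extension [Nontrivial S] (hn : n ≠ 0) {A B D : Type u}
    [AddCommGroup A] [Module (Cover f n) A] [AddCommGroup B] [Module (Cover f n) B]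
    [AddCommGroup D] [Module (Cover f n) D]
    {i : A →ₗ[Cover f n] B} {p : B →ₗ[Cover f n] D}
    (hi : Function.Injective i) (hip : Function.Exact i p) (hp : Function.Surjective p)
    (hD : IsLattice S (Cover f n) D) {r : ℕ} (φ : A →ₗ[Cover f n] (Fin r → Cover f n)) :
    ∃ φ' : B →ₗ[Cover f n] (Fin r → Cover f n), ∀ a, φ' (i a) = φ a := by
  let := Module.compHom A (algebraMap S (Cover f n))
  let := Module.compHom B (algebraMap S (Cover f n))
  let := Module.compHom D (algebraMap S (Cover f n))
  have : IsScalarTower S (Cover f n) A := IsScalarTower.of_algebraMap_smul fun _ _ => rfl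
  have : IsScalarTower S (Cover f n) B := IsScalarTower.of_algebraMap_smul fun _ _ => rfl
  have : IsScalarTower S (Cover f n) D := IsScalarTower.of_algebraMap_smul fun _ _ => rfl
  obtain ⟨-, h4⟩ := isLattice_iff.mp hD
  obtain ⟨σ, hσ⟩ := Module.projective_lifting_property (p.restrictScalars S) LinearMap.id hp
  have hip' : Function.Exact (i.restrictScalars S) (p.restrictScalars S) := hip
  have hi' : Function.Injective (i.restrictScalars S) := hi
  have hp' : Function.Surjective (p.restrictScalars S) := hp
  obtain ⟨ρ, hρ⟩ := (hip'.splitInjectiveEquiv hp').symm (hip'.splitSurjectiveEquiv hi' ⟨σ, hσ⟩)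
  have hρ' (a : A) : ρ (i a) = a := LinearMap.congr_fun hρ a
  -- Each component is reduced to an `S`-functional, extended through the `S`-linear retraction `ρ`,
  -- and coextended back to a `Q`-linear map.
  let φ' (c : Fin r) : B →ₗ[Cover f n] Cover f n :=
    coextend f hn (((topCoeff f hn).comp
      (((LinearMap.proj c).comp φ).restrictScalars S)).comp ρ)
  refine ⟨LinearMap.pi φ', fun a => funext fun c => ?_⟩
  rw [LinearMap.pi_apply]
  change coextend f hn _ (i a) = ((LinearMap.proj c).comp φ) a
  rw [← coextend_topCoeff_comp f hn ((LinearMap.proj c).comp φ) a, coextend_apply, coextend_apply]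
  refine Finset.sum_congr rfl fun j _ => ?_
  rw [← map_smul i]
  simp only [LinearMap.comp_apply, hρ']

/-- A lattice embeds into a finite free module with a lattice as cokernel, and the embedding is
the first factor of a factorization of `n y ^ (n - 1)`. -/
lemma exists_embedding [IsLocalRing S] [IsNoetherianRing S] (hn : n ≠ 0) {A : Type u}
    [AddCommGroup A] [Module (Cover f n) A] (hA : IsLattice S (Cover f n) A) :
    ∃ (m : ℕ) (τ : A →ₗ[Cover f n] (Fin m → Cover f n)) (σ : (Fin m → Cover f n) →ₗ[Cover f n] A),
      Function.Injective τ ∧ IsLattice S (Cover f n) ((Fin m → Cover f n) ⧸ LinearMap.range τ) ∧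
        ∀ a, σ (τ a) = ((n : Cover f n) * y f n ^ (n - 1)) • a := by
  let := Module.compHom A (algebraMap S (Cover f n))
  have : IsScalarTower S (Cover f n) A := IsScalarTower.of_algebraMap_smul fun _ _ => rfl
  obtain ⟨h1, h2⟩ := isLattice_iff.mp hA
  have hQ : Module.Finite S (Cover f n) := (monic f hn).finite_adjoinRoot
  have hQ' : Module.Free S (Cover f n) := (monic f hn).free_adjoinRoot
  have h3 : Module.Finite S A := Module.Finite.trans (Cover f n) A
  have h4 : Module.Free S A := Module.free_of_flat_of_isLocalRing
  let b := Module.finBasis S A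
  let m := Module.finrank S A
  let τ : A →ₗ[Cover f n] (Fin m → Cover f n) := LinearMap.pi fun c => coextend f hn (b.coord c)
  let σ : (Fin m → Cover f n) →ₗ[Cover f n] A :=
    (Fintype.linearCombination (Cover f n) (fun c => b c))
  -- Taking top coefficients recovers the coordinates of `a` from `τ a`, so `τ` splits over `S`.
  let ρ : (Fin m → Cover f n) →ₗ[S] A := (Fintype.linearCombination S (fun c => b c)).comp
    (LinearMap.pi fun c => (topCoeff f hn).comp (LinearMap.proj c))
  have hρ (a : A) : ρ (τ a) = a := by
    change ∑ c, topCoeff f hn (coextend f hn (b.coord c) a) • b c = a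
    simp only [topCoeff_coextend, Module.Basis.coord_apply]
    exact b.sum_repr a
  refine ⟨m, τ, σ, Function.LeftInverse.injective hρ, ?_, fun a => ?_⟩
  · refine IsLattice.of_retraction τ.exact_map_mkQ_range (Submodule.mkQ_surjective _)
      (isLattice_free m) ρ ρ.map_add (fun s v => ?_) hρ
    rw [algebraMap_smul, algebraMap_smul, map_smul]
  · change ∑ c, (∑ i ∈ Finset.range n, b.coord c (y f n ^ i • a) • y f n ^ (n - 1 - i)) • b c = _
    simp only [Finset.sum_smul]
    rw [Finset.sum_comm]
    -- Each of the `n` summands contributes the same `y ^ (n - 1 - i) • y ^ i • a`, whence the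
    -- factor `n`.
    have (i : ℕ) (hi : i ∈ Finset.range n) :
        ∑ c, (b.coord c (y f n ^ i • a) • y f n ^ (n - 1 - i)) • b c = y f n ^ (n - 1) • a := by
      have hi := Finset.mem_range.mp hi
      have h5 : ∑ c, (b.coord c (y f n ^ i • a) • y f n ^ (n - 1 - i)) • b c =
          y f n ^ (n - 1 - i) • ∑ c, b.coord c (y f n ^ i • a) • b c := by
        rw [Finset.smul_sum]
        refine Finset.sum_congr rfl fun c _ => ?_
        rw [smul_assoc, smul_comm]
      rw [h5]
      simp only [Module.Basis.coord_apply]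
      rw [b.sum_repr, smul_smul, ← pow_add]
      congr 2
      omega
    rw [Finset.sum_congr rfl this, Finset.sum_const, Finset.card_range, mul_smul,
      Nat.cast_smul_eq_nsmul]

end Lattice

end Cover

end BranchedCover

namespace BranchedCover

open IsLocalRing RingTheory.Sequence CategoryTheory.Abelian
open scoped Pointwise

/-! ### Maximal Cohen-Macaulay modules over the branched cover -/

namespace Cover

variable {S : Type u} [CommRing S] (f : S) {n : ℕ}

lemma under_eq_maximalIdeal [IsLocalRing S] (hn : n ≠ 0) (I : Ideal (Cover f n)) [I.IsMaximal] :
    I.comap (algebraMap S (Cover f n)) = maximalIdeal S := by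
  have : Module.Finite S (Cover f n) := (monic f hn).finite_adjoinRoot
  exact eq_maximalIdeal (Ideal.isMaximal_comap_of_isIntegral_of_isMaximal I)

lemma y_mem [IsLocalRing S] (hn : n ≠ 0) (hf : ¬IsUnit f) (I : Ideal (Cover f n)) [I.IsMaximal] :
    y f n ∈ I := by
  have h : f ∈ I.comap (algebraMap S (Cover f n)) := by
    rw [under_eq_maximalIdeal f hn]
    exact hf
  refine Ideal.IsPrime.mem_of_pow_mem inferInstance n ?_
  rw [y_pow]
  exact neg_mem h

/-- Every maximal ideal contains `y` and lies over `maximalIdeal S`, so membership depends only on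
the constant coefficient. -/
lemma isLocalRing [IsLocalRing S] (hn : n ≠ 0) (hf : ¬IsUnit f) : IsLocalRing (Cover f n) := by
  have := nontrivial f hn
  have key (I J : Ideal (Cover f n)) (hI : I.IsMaximal) (hJ : J.IsMaximal) : I ≤ J := by
    intro q hq
    obtain ⟨c, rfl⟩ := exists_eq_sum f hn q
    obtain ⟨m, rfl⟩ := Nat.exists_eq_succ_of_ne_zero hn
    have hy {K : Ideal (Cover f (m + 1))} (hK : K.IsMaximal) :
        ∑ i ∈ Finset.range m, c (i + 1) • y f (m + 1) ^ (i + 1) ∈ K := by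
      refine K.sum_mem fun i _ => ?_
      rw [Algebra.smul_def]
      exact K.mul_mem_left _ (Ideal.pow_mem_of_mem _ (y_mem f hn hf K) _ (Nat.succ_pos i))
    rw [Finset.sum_range_succ'] at hq ⊢
    refine J.add_mem (hy hJ) ?_
    have h0 := (I.add_mem_iff_right (hy hI)).mp hq
    rw [pow_zero, Algebra.smul_def, mul_one] at h0 ⊢
    have h1 : c 0 ∈ I.comap (algebraMap S (Cover f (m + 1))) := h0
    rw [under_eq_maximalIdeal f hn, ← under_eq_maximalIdeal f hn J] at h1
    exact h1
  obtain ⟨I, hI⟩ := Ideal.exists_maximal (Cover f n)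
  exact IsLocalRing.of_unique_max_ideal ⟨I, hI, fun J hJ => hJ.eq_of_le hI.ne_top (key J I hJ hI)⟩

lemma map_maximalIdeal_le [IsLocalRing S] [IsLocalRing (Cover f n)] (hn : n ≠ 0) :
    (maximalIdeal S).map (algebraMap S (Cover f n)) ≤ maximalIdeal (Cover f n) := by
  rw [Ideal.map_le_iff_le_comap, under_eq_maximalIdeal f hn]

lemma eq_maximalIdeal_of_map_le [IsLocalRing S] [IsLocalRing (Cover f n)] (hn : n ≠ 0)
    (P : Ideal (Cover f n)) [P.IsPrime]
    (hP : (maximalIdeal S).map (algebraMap S (Cover f n)) ≤ P) : P.IsMaximal := by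
  have : Module.Finite S (Cover f n) := (monic f hn).finite_adjoinRoot
  refine Ideal.isMaximal_of_isIntegral_of_isMaximal_comap (R := S) P ?_
  rw [Ideal.map_le_iff_le_comap] at hP
  rw [← (maximalIdeal.isMaximal S).eq_of_le (Ideal.comap_ne_top _ (Ideal.IsPrime.ne_top'
    (I := P))) hP]
  infer_instance

/-- By integrality, every prime containing the extension of `maximalIdeal S` is maximal. -/
lemma maximalIdeal_le_radical [IsLocalRing S] [IsLocalRing (Cover f n)] (hn : n ≠ 0) :
    maximalIdeal (Cover f n) ≤ ((maximalIdeal S).map (algebraMap S (Cover f n))).radical := by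
  rw [Ideal.radical_eq_sInf]
  refine le_sInf fun P ⟨hle, hP⟩ => ?_
  have := eq_maximalIdeal_of_map_le f hn P hle
  exact (IsLocalRing.eq_maximalIdeal this).ge

/-- A regular sequence generating `maximalIdeal S` stays regular on the flat `S`-algebra `Q`, and
the quotient by it is zero-dimensional. -/
lemma ringKrullDim_eq [IsRegularLocalRing S] [IsLocalRing (Cover f n)] (hn : n ≠ 0) :
    ringKrullDim (Cover f n) = (maximalIdeal S).spanFinrank := by
  obtain ⟨-, rs, hlen, hspan, hreg⟩ := isDomain_and_exists_isRegular _ S rfl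
  have : Module.Finite S (Cover f n) := (monic f hn).finite_adjoinRoot
  have : Module.Free S (Cover f n) := (monic f hn).free_adjoinRoot
  have h1 : IsWeaklyRegular (Cover f n) (rs.map (algebraMap S (Cover f n))) :=
    IsWeaklyRegular.of_flat hreg.1
  have hmem : ∀ r ∈ rs.map (algebraMap S (Cover f n)), r ∈ maximalIdeal (Cover f n) := by
    intro r hr
    obtain ⟨s, hs, rfl⟩ := List.mem_map.mp hr
    refine map_maximalIdeal_le f hn (Ideal.mem_map_of_mem _ ?_)
    rw [← hspan]
    exact Ideal.subset_span hs
  have h2 := ringKrullDim_add_length_eq_ringKrullDim_of_isRegular _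
    (IsRegular.of_isWeaklyRegular_of_mem_maximalIdeal _ hmem h1)
  have h3 : Ring.KrullDimLE 0 (Cover f n ⧸ Ideal.ofList (rs.map (algebraMap S (Cover f n)))) := by
    refine Ring.krullDimLE_zero_iff.mpr fun J hJ => ?_
    have h4 := eq_maximalIdeal_of_map_le f hn (J.comap (Ideal.Quotient.mk _)) (by
      rw [← hspan, Ideal.map_ofList]
      intro x hx
      rw [Ideal.mem_comap, Ideal.Quotient.eq_zero_iff_mem.mpr hx]
      exact zero_mem J)
    rw [← Ideal.map_comap_of_surjective _ Ideal.Quotient.mk_surjective J]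
    refine (Ideal.map_eq_top_or_isMaximal_of_surjective _ Ideal.Quotient.mk_surjective
      h4).resolve_left fun h => hJ.ne_top ?_
    rwa [Ideal.map_comap_of_surjective _ Ideal.Quotient.mk_surjective] at h
  have hnt : Nontrivial (Cover f n ⧸ Ideal.ofList (rs.map (algebraMap S (Cover f n)))) :=
    Ideal.Quotient.nontrivial_iff.mpr fun h => by
      have : Ideal.ofList (rs.map (algebraMap S (Cover f n))) ≤ maximalIdeal (Cover f n) :=
        Ideal.span_le.mpr hmem
      rw [h] at this
      exact (maximalIdeal.isMaximal (Cover f n)).ne_top (top_le_iff.mp this)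
  rw [← h2, ringKrullDimZero_iff_ringKrullDim_eq_zero.mp h3, zero_add, List.length_map, hlen]

/-- The nonzero element `f` is regular on an `S`-projective module, and `y ^ n = -f`. -/
lemma isSMulRegular_y_pow [IsDomain S] (hf : f ≠ 0) (hn : n ≠ 0) {X : Type u} [AddCommGroup X]
    [Module (Cover f n) X] (hX : IsLattice S (Cover f n) X) (k : ℕ) :
    IsSMulRegular X (y f n ^ k) := by
  refine IsSMulRegular.pow k ?_
  let := Module.compHom X (algebraMap S (Cover f n))
  have : IsScalarTower S (Cover f n) X := IsScalarTower.of_algebraMap_smul fun _ _ => rfl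
  obtain ⟨-, h2⟩ := isLattice_iff.mp hX
  have h3 : IsSMulRegular X f :=
    Module.Flat.isSMulRegular_of_nonZeroDivisors (mem_nonZeroDivisors_of_ne_zero hf)
  have h4 : IsSMulRegular X (y f n ^ n) := by
    intro a b hab
    simp only [y_pow, neg_smul, algebraMap_smul, neg_inj] at hab
    exact h3 hab
  exact (IsSMulRegular.pow_iff (Nat.pos_of_ne_zero hn)).mp h4

lemma depthGE_of_isMCM [IsRegularLocalRing S] [IsLocalRing (Cover f n)] (hn : n ≠ 0)
    {X : ModuleCat.{u} (Cover f n)} (hX : IsMCM (Cover f n) X) :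
    DepthGE (Cover f n) (maximalIdeal S).spanFinrank X := by
  obtain ⟨hfin, h⟩ := hX
  cases subsingleton_or_nontrivial X with
  | inl hs => exact DepthGE.of_subsingleton _ X
  | inr hs =>
    obtain ⟨rs, hmem, hreg, hlen⟩ := h.resolve_left (not_subsingleton X)
    rw [ringKrullDim_eq f hn] at hlen
    exact (depthGE_iff_exists_isRegular _ X).mpr ⟨rs, by exact_mod_cast hlen, hmem, hreg⟩

lemma isMCM_of_depthGE [IsRegularLocalRing S] [IsLocalRing (Cover f n)] (hn : n ≠ 0)
    {X : ModuleCat.{u} (Cover f n)} [Module.Finite (Cover f n) X]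
    (hX : DepthGE (Cover f n) (maximalIdeal S).spanFinrank X) : IsMCM (Cover f n) X := by
  refine ⟨inferInstance, ?_⟩
  cases subsingleton_or_nontrivial X with
  | inl hs => exact Or.inl hs
  | inr hs =>
    obtain ⟨rs, hlen, hmem, hreg⟩ := (depthGE_iff_exists_isRegular _ X).mp hX
    exact Or.inr ⟨rs, hmem, hreg, by rw [ringKrullDim_eq f hn, hlen]⟩

/-- Over the branched cover of a regular local ring, the maximal Cohen-Macaulay modules are the
lattices. -/
lemma isMCM_iff_isLattice [IsRegularLocalRing S] (hn : n ≠ 0) (hf : ¬IsUnit f)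
    (X : ModuleCat.{u} (Cover f n)) : IsMCM (Cover f n) X ↔ IsLattice S (Cover f n) X := by
  have := isLocalRing f hn hf
  have : Module.Finite S (Cover f n) := (monic f hn).finite_adjoinRoot
  let := Module.compHom X (algebraMap S (Cover f n))
  have : IsScalarTower S (Cover f n) X := IsScalarTower.of_algebraMap_smul fun _ _ => rfl
  constructor
  · intro hX
    have hfin := hX.1
    have hfin' : Module.Finite S X := Module.Finite.trans (Cover f n) X
    refine isLattice_iff.mpr ⟨hfin, ?_⟩
    cases subsingleton_or_nontrivial X with
    | inl hs => infer_instance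
    | inr hs =>
      obtain ⟨rs, hlen, hmem, hrs⟩ := exists_isWeaklyRegular_of_depthGE
        (maximalIdeal_le_radical f hn) _ X (depthGE_of_isMCM f hn hX)
      have := free_of_isRegular _ S X rs rfl hlen hmem
        (IsRegular.of_isWeaklyRegular_of_mem_maximalIdeal _ hmem
          ((isWeaklyRegular_map_algebraMap_iff _ _ _).mp hrs))
      infer_instance
  · intro hX
    obtain ⟨hfin, hproj⟩ := isLattice_iff.mp hX
    apply isMCM_of_depthGE f hn
    cases subsingleton_or_nontrivial X with
    | inl hs => exact DepthGE.of_subsingleton _ X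
    | inr hs =>
      obtain ⟨-, rs, hlen, hspan, hreg⟩ := isDomain_and_exists_isRegular _ S rfl
      -- Flatness of `X` over `S` carries the regular sequence from `S` to `S ⊗ X`.
      have h1 : IsWeaklyRegular X rs :=
        ((TensorProduct.rid S X).isWeaklyRegular_congr rs).mp hreg.1.isWeaklyRegular_lTensor
      have hmem : ∀ r ∈ rs.map (algebraMap S (Cover f n)), r ∈ maximalIdeal (Cover f n) := by
        intro r hr
        obtain ⟨s, hs, rfl⟩ := List.mem_map.mp hr
        refine map_maximalIdeal_le f hn (Ideal.mem_map_of_mem _ ?_)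
        rw [← hspan]
        exact Ideal.subset_span hs
      exact (depthGE_iff_exists_isRegular _ X).mpr ⟨rs.map (algebraMap S (Cover f n)),
        by rw [List.length_map, hlen], hmem, IsRegular.of_isWeaklyRegular_of_mem_maximalIdeal _ hmem
          ((isWeaklyRegular_map_algebraMap_iff _ _ _).mpr h1)⟩

/-! ### Reduction modulo powers of `y` -/

section Quotient

variable [IsRegularLocalRing S] {k : ℕ}

lemma isLocalRing_quotient (hf : ¬IsUnit f) (hn : n ≠ 0) (hk : k ≠ 0) :
    IsLocalRing (Cover f n ⧸ Ideal.span {y f n ^ k}) := by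
  have := isLocalRing f hn hf
  exact isLocalRing_quotient_span_singleton
    (Ideal.pow_mem_of_mem _ (y_mem f hn hf _) _ (Nat.pos_of_ne_zero hk))

lemma ringKrullDim_quotient_succ (hf0 : f ≠ 0) (hf : ¬IsUnit f) (hn : n ≠ 0) (hk : k ≠ 0) :
    ringKrullDim (Cover f n ⧸ Ideal.span {y f n ^ k}) + 1 =
    (maximalIdeal S).spanFinrank := by
  have := isLocalRing f hn hf
  have : Module.Free S (Cover f n) := (monic f hn).free_adjoinRoot
  obtain ⟨hdom, -⟩ := isDomain_and_exists_isRegular _ S rfl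
  have h : IsLattice S (Cover f n) (Cover f n) := isLattice_iff.mpr ⟨inferInstance, inferInstance⟩
  rw [← ringKrullDim_eq f hn]
  exact ringKrullDim_quotient_span_singleton_succ_eq_ringKrullDim
    (isSMulRegular_y_pow f hf0 hn h k)
    (Ideal.pow_mem_of_mem _ (y_mem f hn hf _) _ (Nat.pos_of_ne_zero hk))

/-- A nonzero nonunit `f` forces `S` to have positive dimension, so one can be subtracted within
`ℕ`. -/
lemma exists_ringKrullDim_quotient_eq (hf0 : f ≠ 0) (hf : ¬IsUnit f) (hn : n ≠ 0) (hk : k ≠ 0) :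
    ∃ e : ℕ, (maximalIdeal S).spanFinrank = e + 1 ∧
      ringKrullDim (Cover f n ⧸ Ideal.span {y f n ^ k}) = e := by
  have := isLocalRing_quotient f hf hn hk
  have h1 := ringKrullDim_quotient_succ f hf0 hf hn hk
  obtain ⟨hdom, -⟩ := isDomain_and_exists_isRegular _ S rfl
  have h0 : (maximalIdeal S).spanFinrank ≠ 0 := fun h => by
    have hbot := (Submodule.spanFinrank_eq_zero_iff_eq_bot
      (maximalIdeal S).fg_of_isNoetherianRing).mp h
    have hmem : f ∈ maximalIdeal S := hf
    rw [hbot] at hmem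
    exact hf0 hmem
  obtain ⟨e, he⟩ := Nat.exists_eq_succ_of_ne_zero h0
  refine ⟨e, he, ?_⟩
  rw [he, Nat.succ_eq_add_one, Nat.cast_add, Nat.cast_one] at h1
  have h2 (a : WithBot ℕ∞) (h : a + 1 = (e : WithBot ℕ∞) + 1) : a = e := by
    have h3 : a + ((1 : ℕ) : WithBot ℕ∞) = (e : WithBot ℕ∞) + ((1 : ℕ) : WithBot ℕ∞) := by
      exact_mod_cast h
    exact le_antisymm (ENat.WithBot.add_le_add_natCast_right_iff.mp h3.le)
      (ENat.WithBot.add_le_add_natCast_right_iff.mp h3.ge)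
  exact h2 _ h1

/-- The reduction of a lattice modulo `y ^ k` is maximal Cohen-Macaulay over `Q / (y ^ k)`. -/
lemma isMCM_quotSMulTop (hf0 : f ≠ 0) (hf : ¬IsUnit f) (hn : n ≠ 0) (hk : k ≠ 0)
    {X : Type u} [AddCommGroup X] [Module (Cover f n) X]
    (hX : IsLattice S (Cover f n) X) :
    IsMCM (Cover f n ⧸ Ideal.span {y f n ^ k})
      (ModuleCat.of (Cover f n ⧸ Ideal.span {y f n ^ k}) (QuotSMulTop (y f n ^ k) X)) := by
  have := isLocalRing f hn hf
  have := isLocalRing_quotient f hf hn hk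
  obtain ⟨hdom, -⟩ := isDomain_and_exists_isRegular _ S rfl
  obtain ⟨e, he, hdim⟩ := exists_ringKrullDim_quotient_eq f hf0 hf hn hk
  have hdepth := depthGE_of_isMCM f hn ((isMCM_iff_isLattice f hn hf (ModuleCat.of _ X)).mpr hX)
  rw [he] at hdepth
  have hq := hdepth.quotSMulTop (isSMulRegular_y_pow f hf0 hn hX k)
  have hfin : Module.Finite (Cover f n) X := hX.1
  have hfin' : Module.Finite (Cover f n ⧸ Ideal.span {y f n ^ k}) (QuotSMulTop (y f n ^ k) X) :=
    Module.Finite.of_restrictScalars_finite (Cover f n) _ _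
  refine ⟨hfin', ?_⟩
  rw [hdim]
  cases subsingleton_or_nontrivial (QuotSMulTop (y f n ^ k) X) with
  | inl hs => exact Or.inl hs
  | inr hs =>
    obtain ⟨rs, hlen, hmem, hreg⟩ := (depthGE_iff_exists_isRegular e
      (ModuleCat.of (Cover f n) (QuotSMulTop (y f n ^ k) X))).mp hq
    have hmem' : ∀ r ∈ rs.map (algebraMap (Cover f n) (Cover f n ⧸ Ideal.span {y f n ^ k})),
        r ∈ maximalIdeal (Cover f n ⧸ Ideal.span {y f n ^ k}) := by
      intro r hr
      obtain ⟨t, ht, rfl⟩ := List.mem_map.mp hr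
      rw [← map_maximalIdeal_of_surjective (Ideal.Quotient.mk (Ideal.span {y f n ^ k}))
        Ideal.Quotient.mk_surjective]
      exact Ideal.mem_map_of_mem _ (hmem t ht)
    refine Or.inr ⟨rs.map (algebraMap _ _), hmem', ?_, by rw [List.length_map, hlen]⟩
    exact IsRegular.of_isWeaklyRegular_of_mem_maximalIdeal _ hmem'
        ((isWeaklyRegular_map_algebraMap_iff _ _ _).mpr hreg.1)

/-- Syzygies over `Q` of maximal Cohen-Macaulay modules over `Q / (y ^ k)` are lattices. -/
lemma isLattice_of_syzygySequence (hf0 : f ≠ 0) (hf : ¬IsUnit f) (hn : n ≠ 0) (hk : k ≠ 0)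
    (M : ModuleCat.{u} (Cover f n ⧸ Ideal.span {y f n ^ k}))
    (hM : IsMCM (Cover f n ⧸ Ideal.span {y f n ^ k}) M) (N : ModuleCat.{u} (Cover f n))
    (s : SyzygySequence (Cover f n) N
      ((ModuleCat.restrictScalars (Ideal.Quotient.mk (Ideal.span {y f n ^ k}))).obj M)) :
    IsLattice S (Cover f n) N := by
  have := isLocalRing f hn hf
  have := isLocalRing_quotient f hf hn hk
  have : Module.Free S (Cover f n) := (monic f hn).free_adjoinRoot
  obtain ⟨e, he, hdim⟩ := exists_ringKrullDim_quotient_eq f hf0 hf hn hk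
  let M' := (ModuleCat.restrictScalars (Ideal.Quotient.mk (Ideal.span {y f n ^ k}))).obj M
  have hfinM : Module.Finite (Cover f n) M' :=
    Module.Finite.of_surjective s.proj.hom s.proj_surjective
  have hfinN : Module.Finite (Cover f n) N := by
    have := isNoetherian_of_injective s.incl.hom s.incl_injective
    infer_instance
  have hM' : DepthGE (Cover f n) e M' := by
    cases subsingleton_or_nontrivial M' with
    | inl hs => exact DepthGE.of_subsingleton _ M'
    | inr hs =>
      have hs' : Nontrivial M := hs
      obtain ⟨rs, hmem, hreg, hlen⟩ := hM.2.resolve_left (not_subsingleton M)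
      rw [hdim] at hlen
      choose g hg using Ideal.Quotient.mk_surjective (I := Ideal.span {y f n ^ k})
      have hmap : (rs.map g).map (Ideal.Quotient.mk (Ideal.span {y f n ^ k})) = rs := by
        rw [List.map_map]
        conv_rhs => rw [← List.map_id rs]
        exact List.map_congr_left fun a _ => hg a
      have hmem' : ∀ r ∈ rs.map g, r ∈ maximalIdeal (Cover f n) := by
        intro r hr
        obtain ⟨t, ht, rfl⟩ := List.mem_map.mp hr
        intro hu
        exact hmem t ht (by rw [← hg t]; exact hu.map _)
      refine (depthGE_iff_exists_isRegular e M').mpr ⟨rs.map g, ?_, hmem', ?_⟩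
      · rw [List.length_map]
        exact_mod_cast hlen
      · refine IsRegular.of_isWeaklyRegular_of_mem_maximalIdeal _ hmem' ?_
        let e : M' ≃+ M := AddEquiv.refl M
        refine (e.isWeaklyRegular_congr (as := rs.map g) (bs := rs) ?_).mpr hreg.1
        rw [List.forall₂_map_left_iff, List.forall₂_same]
        intro r _ x
        change Ideal.Quotient.mk (Ideal.span {y f n ^ k}) (g r) • e x = r • e x
        rw [hg]
  have hF := depthGE_of_isMCM f hn ((isMCM_iff_isLattice f hn hf
    (ModuleCat.of (Cover f n) (Fin s.rank → Cover f n))).mpr (isLattice_free s.rank))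
  rw [he] at hF
  have hzero : s.incl ≫ s.proj = 0 := by
    ext x
    exact s.exact.apply_apply_eq_zero x
  let T : ShortComplex (ModuleCat.{u} (Cover f n)) := ShortComplex.mk s.incl s.proj hzero
  have hT : T.ShortExact :=
    { exact := (ShortComplex.ShortExact.moduleCat_exact_iff_function_exact T).mpr s.exact
      mono_f := (ModuleCat.mono_iff_injective _).mpr s.incl_injective
      epi_g := (ModuleCat.epi_iff_surjective _).mpr s.proj_surjective }
  -- The free module has depth at least `e + 1` and `M'` at least `e`, so the kernel regains the
  -- lost unit of depth.
  have hN : DepthGE (Cover f n) (e + 1) N := DepthGE.kernel hT hF hM'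
  rw [← he] at hN
  exact (isMCM_iff_isLattice f hn hf N).mp (isMCM_of_depthGE f hn hN)

end Quotient

end Cover

end BranchedCover

namespace BranchedCover

open scoped Pointwise

/-! ### Stable annihilators -/

/-- Multiplication by `q` on `X` factors through a finite free module. -/
def StablyKills {Q : Type u} [CommRing Q] (q : Q) (X : Type u) [AddCommGroup X] [Module Q X] :
    Prop :=
  ∃ (r : ℕ) (a : X →ₗ[Q] (Fin r → Q)) (b : (Fin r → Q) →ₗ[Q] X), ∀ x, b (a x) = q • x

section StablyKills

variable {Q : Type u} [CommRing Q] {q : Q} {X Y : Type u} [AddCommGroup X] [Module Q X]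
  [AddCommGroup Y] [Module Q Y]

/-- A finite projective module is a retract of a finite free one; this allows factorizations through
products of free modules. -/
lemma StablyKills.of_factor {P : Type u} [AddCommGroup P] [Module Q P] [Module.Finite Q P]
    [Module.Projective Q P] (a : X →ₗ[Q] P) (b : P →ₗ[Q] X) (h : ∀ x, b (a x) = q • x) :
    StablyKills q X := by
  obtain ⟨r, p, hp⟩ := Module.Finite.exists_fin' Q P
  obtain ⟨s, hs⟩ := Module.projective_lifting_property p LinearMap.id hp
  refine ⟨r, s ∘ₗ a, b ∘ₗ p, fun x => ?_⟩
  rw [← h x]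
  exact congrArg b (LinearMap.congr_fun hs (a x))

lemma StablyKills.of_retract (h : StablyKills q Y) (i : X →ₗ[Q] Y) (p : Y →ₗ[Q] X)
    (hip : ∀ x, p (i x) = x) : StablyKills q X := by
  obtain ⟨r, a, b, hab⟩ := h
  refine ⟨r, a ∘ₗ i, p ∘ₗ b, fun x => ?_⟩
  rw [LinearMap.comp_apply, LinearMap.comp_apply, hab, map_smul, hip]

lemma StablyKills.pi {m : ℕ} {Z : Fin m → Type u} [∀ i, AddCommGroup (Z i)] [∀ i, Module Q (Z i)]
    (h : ∀ i, StablyKills q (Z i)) : StablyKills q (∀ i, Z i) := by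
  choose r a b hab using h
  refine StablyKills.of_factor (P := ∀ i, Fin (r i) → Q) (LinearMap.piMap a) (LinearMap.piMap b)
    fun x => funext fun i => ?_
  exact hab i (x i)

end StablyKills

/-! ### The classes of syzygies of modules killed by a power of `y` -/

namespace Cover

variable {S : Type u} [CommRing S] (f : S) {n : ℕ}

/-- Since `q` kills `M`, it carries the free module into `N`; inclusion followed by this map is `q`
on `N`. -/
lemma stablyKills_of_syzygySequence {Q : Type u} [CommRing Q] {q : Q}
    {M : ModuleCat.{u} (Q ⧸ Ideal.span {q})} {N : ModuleCat.{u} Q}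
    (s : SyzygySequence Q N
      ((ModuleCat.restrictScalars (Ideal.Quotient.mk (Ideal.span {q}))).obj M)) :
    StablyKills q N := by
  have hrange (v : Fin s.rank → Q) :
      (q • (LinearMap.id : (Fin s.rank → Q) →ₗ[Q] _)) v ∈ LinearMap.range s.incl.hom := by
    refine (s.exact (q • v)).mp ?_
    have h1 : s.proj (q • v) = q • s.proj v := map_smul s.proj.hom q v
    rw [h1]
    change Ideal.Quotient.mk (Ideal.span {q}) q • (show M from s.proj v) = 0
    rw [Ideal.Quotient.eq_zero_iff_mem.mpr (Ideal.mem_span_singleton_self q), zero_smul]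
  let e := LinearEquiv.ofInjective s.incl.hom s.incl_injective
  refine ⟨s.rank, s.incl.hom, e.symm.toLinearMap ∘ₗ LinearMap.codRestrict _ _ hrange, fun x => ?_⟩
  rw [LinearMap.comp_apply, LinearEquiv.coe_coe, LinearEquiv.symm_apply_eq]
  ext1
  change q • s.incl.hom x = s.incl.hom (q • x)
  rw [map_smul]

/-- A module on which `q` acts stably as zero is a retract of the kernel of `G → X → X / q X`. -/
lemma exists_retract_ker {Q : Type u} [CommRing Q] {q : Q} {X G : Type u} [AddCommGroup X]
    [Module Q X] [AddCommGroup G] [Module Q G] (hq : IsSMulRegular X q) (hX : StablyKills q X)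
    (g : G →ₗ[Q] X) (hg : Function.Surjective g) :
    ∃ (ι : X →ₗ[Q] LinearMap.ker ((q • (⊤ : Submodule Q X)).mkQ ∘ₗ g))
      (θ : LinearMap.ker ((q • (⊤ : Submodule Q X)).mkQ ∘ₗ g) →ₗ[Q] X), ∀ x, θ (ι x) = x := by
  obtain ⟨r, a, b, hab⟩ := hX
  obtain ⟨b', hb'⟩ := Module.projective_lifting_property g b hg
  have hb (v) : g (b' v) = b v := LinearMap.congr_fun hb' v
  let m : X →ₗ[Q] X := LinearMap.lsmul Q X q
  let e := LinearEquiv.ofInjective m hq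
  -- On the kernel `g` takes values in `q X`, so it can be divided by the regular element `q`; this
  -- quotient is `θ`. The section `ι` is `b' ∘ a`, as `g ∘ b' ∘ a = q`.
  have hmem (z : LinearMap.ker ((q • (⊤ : Submodule Q X)).mkQ ∘ₗ g)) :
      (g ∘ₗ Submodule.subtype _) z ∈ LinearMap.range m := by
    have h1 := z.2
    rw [LinearMap.mem_ker, LinearMap.comp_apply, Submodule.mkQ_apply,
      Submodule.Quotient.mk_eq_zero] at h1
    obtain ⟨x, -, hx⟩ := (Submodule.mem_smul_pointwise_iff_exists _ _ _).mp h1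
    exact ⟨x, hx⟩
  have hmem' (x : X) : (b' ∘ₗ a) x ∈ LinearMap.ker ((q • (⊤ : Submodule Q X)).mkQ ∘ₗ g) := by
    rw [LinearMap.mem_ker, LinearMap.comp_apply, LinearMap.comp_apply, hb, hab,
      Submodule.mkQ_apply, Submodule.Quotient.mk_eq_zero]
    exact Submodule.smul_mem_pointwise_smul _ _ _ trivial
  refine ⟨LinearMap.codRestrict _ _ hmem', e.symm.toLinearMap ∘ₗ LinearMap.codRestrict _ _ hmem,
    fun x => ?_⟩
  rw [LinearMap.comp_apply, LinearEquiv.coe_coe, LinearEquiv.symm_apply_eq]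
  ext1
  change g (b' (a x)) = q • x
  rw [hb, hab]

section Sigma

variable [IsRegularLocalRing S] {k : ℕ}

lemma syzygiesOfMCM_ker (hf0 : f ≠ 0) (hf : ¬IsUnit f) (hn : n ≠ 0) (hk : k ≠ 0) {X : Type u}
    [AddCommGroup X] [Module (Cover f n) X] (hX : IsLattice S (Cover f n) X) {s : ℕ}
    (π : (Fin s → Cover f n) →ₗ[Cover f n] X) (hπ : Function.Surjective π) :
    syzygiesOfMCM (Cover f n) (y f n) k (ModuleCat.of (Cover f n)
      (LinearMap.ker ((y f n ^ k • (⊤ : Submodule (Cover f n) X)).mkQ ∘ₗ π))) := by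
  let g := (y f n ^ k • (⊤ : Submodule (Cover f n) X)).mkQ ∘ₗ π
  let M := ModuleCat.of (Cover f n ⧸ Ideal.span {y f n ^ k}) (QuotSMulTop (y f n ^ k) X)
  let g' : (Fin s → Cover f n) →ₗ[Cover f n]
      (ModuleCat.restrictScalars (Ideal.Quotient.mk (Ideal.span {y f n ^ k}))).obj M :=
    { toFun := g
      map_add' := g.map_add
      map_smul' := g.map_smul }
  refine ⟨M, isMCM_quotSMulTop f hf0 hf hn hk hX, ⟨
    { rank := s
      incl := ModuleCat.ofHom (LinearMap.ker g).subtype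
      proj := ModuleCat.ofHom g'
      incl_injective := Subtype.val_injective
      exact := LinearMap.exact_subtype_ker_map g
      proj_surjective := (Submodule.mkQ_surjective _).comp hπ }⟩⟩

/-- The class `Σ_k` consists of the maximal Cohen-Macaulay modules on which `y ^ k` is stably
zero. -/
lemma sigma_iff (hf0 : f ≠ 0) (hf : ¬IsUnit f) (hn : n ≠ 0) (hk : k ≠ 0)
    (X : ModuleCat.{u} (Cover f n)) : Sigma (Cover f n) (y f n) k X ↔
      IsMCM (Cover f n) X ∧ StablyKills (y f n ^ k) X := by
  rw [isMCM_iff_isLattice f hn hf]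
  obtain ⟨hdom, -⟩ := isDomain_and_exists_isRegular _ S rfl
  constructor
  · rintro ⟨r, Z, N', hZ, ⟨e⟩⟩
    have h1 (i : Fin r) : IsLattice S (Cover f n) (Z i) := by
      obtain ⟨M, hM, ⟨s⟩⟩ := hZ i
      exact isLattice_of_syzygySequence f hf0 hf hn hk M hM _ s
    have h2 (i : Fin r) : StablyKills (y f n ^ k) (Z i) := by
      obtain ⟨M, hM, ⟨s⟩⟩ := hZ i
      exact stablyKills_of_syzygySequence s
    exact ⟨((IsLattice.pi h1).equiv e.symm).of_prod, (StablyKills.pi h2).of_retract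
      (e.toLinearMap ∘ₗ LinearMap.inl _ _ _) (LinearMap.fst _ _ _ ∘ₗ e.symm.toLinearMap)
      fun x => by simp⟩
  · rintro ⟨hX, hkill⟩
    have hfin := hX.1
    obtain ⟨s, π, hπ⟩ := Module.Finite.exists_fin' (Cover f n) X
    obtain ⟨ι, θ, hθ⟩ := exists_retract_ker (isSMulRegular_y_pow f hf0 hn hX k) hkill π hπ
    have hexact : Function.Exact (LinearMap.ker θ).subtype θ := LinearMap.exact_subtype_ker_map θ
    -- The complement of `X` in the syzygy is the kernel of the retraction.
    obtain ⟨e, -⟩ := hexact.splitSurjectiveEquiv (Submodule.injective_subtype _)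
      ⟨ι, LinearMap.ext hθ⟩
    refine ⟨1, fun _ => ModuleCat.of _ _, ModuleCat.of _ (LinearMap.ker θ),
      fun _ => syzygiesOfMCM_ker f hf0 hf hn hk hX π hπ, ⟨?_⟩⟩
    exact ((LinearEquiv.prodComm _ _ _).trans e.symm).trans
      (LinearEquiv.funUnique (Fin 1) (Cover f n) _).symm

/-- A lattice on which `y ^ k` is stably zero is a retract of an extension of a member of `Σ_j` by
a member of `Σ_{k-j}`. -/
lemma exists_extension_retract (hf0 : f ≠ 0) (hf : ¬IsUnit f) (hn : n ≠ 0) {j : ℕ} (hj : j ≠ 0)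
    (hjk : j < k) {X : Type u} [AddCommGroup X] [Module (Cover f n) X]
    (hX : IsLattice S (Cover f n) X) (hkill : StablyKills (y f n ^ k) X) :
    ∃ (A P B : ModuleCat.{u} (Cover f n)) (i : A →ₗ[Cover f n] P) (p : P →ₗ[Cover f n] B),
      Function.Injective i ∧ Function.Exact i p ∧ Function.Surjective p ∧
      syzygiesOfMCM (Cover f n) (y f n) (k - j) A ∧ syzygiesOfMCM (Cover f n) (y f n) j B ∧
      ∃ (ι : X →ₗ[Cover f n] P) (θ : P →ₗ[Cover f n] X), ∀ x, θ (ι x) = x := by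
  obtain ⟨hdom, -⟩ := isDomain_and_exists_isRegular _ S rfl
  have hfin := hX.1
  obtain ⟨s, π, hπ⟩ := Module.Finite.exists_fin' (Cover f n) X
  let F := Fin s → Cover f n
  -- The second summand is redundant for surjectivity; it is there so that projecting the kernel `P`
  -- to `u` exhibits it as an extension.
  let g : (F × F) →ₗ[Cover f n] X := π.coprod (y f n ^ j • π)
  have hg (u w : F) : g (u, w) = π u + y f n ^ j • π w := LinearMap.coprod_apply _ _ _
  have hgs : Function.Surjective g := fun x => by
    obtain ⟨u, rfl⟩ := hπ x
    exact ⟨(u, 0), by rw [hg, map_zero, smul_zero, add_zero]⟩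
  obtain ⟨ι, θ, hθ⟩ := exists_retract_ker (isSMulRegular_y_pow f hf0 hn hX k) hkill g hgs
  have mem_ker {l : ℕ} {G : Type u} [AddCommGroup G] [Module (Cover f n) G]
      (h : G →ₗ[Cover f n] X) (v : G) :
      v ∈ LinearMap.ker ((y f n ^ l • (⊤ : Submodule (Cover f n) X)).mkQ ∘ₗ h) ↔
        ∃ x, y f n ^ l • x = h v := by
    rw [LinearMap.mem_ker, LinearMap.comp_apply, Submodule.mkQ_apply,
      Submodule.Quotient.mk_eq_zero, Submodule.mem_smul_pointwise_iff_exists]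
    simp
  have hpow (x : X) : y f n ^ k • x = y f n ^ j • y f n ^ (k - j) • x := by
    rw [smul_smul, ← pow_add]
    congr 2
    omega
  let A := LinearMap.ker ((y f n ^ (k - j) • (⊤ : Submodule (Cover f n) X)).mkQ ∘ₗ π)
  let B := LinearMap.ker ((y f n ^ j • (⊤ : Submodule (Cover f n) X)).mkQ ∘ₗ π)
  let P := LinearMap.ker ((y f n ^ k • (⊤ : Submodule (Cover f n) X)).mkQ ∘ₗ g)
  have hi (w : A) : (LinearMap.inr (Cover f n) F F ∘ₗ A.subtype) w ∈ P := by
    obtain ⟨x, hx⟩ := (mem_ker π w.1).mp w.2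
    refine (mem_ker g _).mpr ⟨x, ?_⟩
    change _ = g (0, w.1)
    rw [hg, map_zero, zero_add, hpow, hx]
  have hp (z : P) : (LinearMap.fst (Cover f n) F F ∘ₗ P.subtype) z ∈ B := by
    obtain ⟨⟨u, w⟩, hz⟩ := z
    obtain ⟨x, hx⟩ := (mem_ker g _).mp hz
    -- From `y ^ k x = π u + y ^ j π w`, factor `y ^ j` out of `π u`.
    refine (mem_ker π _).mpr ⟨y f n ^ (k - j) • x - π w, ?_⟩
    change _ = π u
    rw [smul_sub, ← hpow, hx, hg, add_sub_cancel_right]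
  refine ⟨ModuleCat.of _ A, ModuleCat.of _ P, ModuleCat.of _ B,
    LinearMap.codRestrict P _ hi, LinearMap.codRestrict B _ hp, ?_, ?_, ?_,
    syzygiesOfMCM_ker f hf0 hf hn (by omega) hX π hπ,
    syzygiesOfMCM_ker f hf0 hf hn hj hX π hπ, ι, θ, hθ⟩
  · intro w w' h
    exact Subtype.ext (congrArg Prod.snd (congrArg Subtype.val h))
  · rintro ⟨⟨u, w⟩, hz⟩
    constructor
    · intro h
      have hu : u = 0 := congrArg Subtype.val h
      subst hu
      obtain ⟨x, hx⟩ := (mem_ker g _).mp hz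
      rw [hg, map_zero, zero_add, hpow] at hx
      exact ⟨⟨w, (mem_ker π w).mpr ⟨x, isSMulRegular_y_pow f hf0 hn hX j hx⟩⟩, rfl⟩
    · rintro ⟨w', h⟩
      exact Subtype.ext (congrArg Prod.fst (congrArg Subtype.val h)).symm
  · rintro ⟨u, hu⟩
    obtain ⟨x, hx⟩ := (mem_ker π u).mp hu
    -- Lifting `-x` makes `g (u, w) = y ^ j x - y ^ j x = 0`.
    obtain ⟨w, hw⟩ := hπ (-x)
    refine ⟨⟨(u, w), (mem_ker g _).mpr ⟨0, ?_⟩⟩, rfl⟩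
    rw [hg, hw, ← hx, smul_zero, smul_neg, add_neg_cancel]

/-- If `n` is invertible, then `y ^ (n - 1)` is stably zero on every lattice. -/
lemma stablyKills_of_isUnit (hn : n ≠ 0) (hu : IsUnit (n : S)) {X : Type u} [AddCommGroup X]
    [Module (Cover f n) X] (hX : IsLattice S (Cover f n) X) :
    StablyKills (y f n ^ (n - 1)) X := by
  obtain ⟨m, τ, σ, -, -, h⟩ := exists_embedding f hn hX
  have hu' : IsUnit (n : Cover f n) := by
    have := hu.map (algebraMap S (Cover f n))
    rwa [map_natCast] at this
  obtain ⟨c, hc⟩ := hu'.exists_left_inv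
  refine ⟨m, τ, c • σ, fun x => ?_⟩
  rw [LinearMap.smul_apply, h, smul_smul, ← mul_assoc, hc, one_mul]

end Sigma

end Cover

end BranchedCover

namespace BranchedCover

/-! ### Stable annihilators in the stable category -/

section Stable

variable {Q : Type u} [CommRing Q]

/-- The objects of the stable category on which `q` acts as zero. -/
def stablyZero (q : Q) : ObjectProperty (StableMCM Q) := fun X => StablyKills q X.as.obj

lemma toStable_map_eq_iff {X Y : MCM Q} (f g : X ⟶ Y) :
    (toStable Q).map f = (toStable Q).map g ↔
      ∃ (r : ℕ) (a : X.obj →ₗ[Q] (Fin r → Q)) (b : (Fin r → Q) →ₗ[Q] Y.obj),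
        ∀ x, f.hom x - g.hom x = b (a x) := by
  rw [Quotient.functor_map_eq_iff]
  constructor
  · rintro ⟨r, a, b, h⟩
    exact ⟨r, a.hom, b.hom, fun x => congrArg (fun φ : X.obj ⟶ Y.obj => φ x) h⟩
  · rintro ⟨r, a, b, h⟩
    exact ⟨r, ModuleCat.ofHom a, ModuleCat.ofHom b, ModuleCat.hom_ext (LinearMap.ext h)⟩

/-- Phrasing the condition as an equality of stable endomorphisms lets it be tested by universal
properties. -/
lemma stablyZero_iff (q : Q) (X : MCM Q) : stablyZero q ((toStable Q).obj X) ↔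
    (toStable Q).map (ObjectProperty.homMk (q • 𝟙 X.obj) : X ⟶ X) =
      (toStable Q).map (ObjectProperty.homMk 0 : X ⟶ X) := by
  rw [toStable_map_eq_iff]
  refine exists_congr fun r => exists_congr fun a => exists_congr fun b => forall_congr' fun x => ?_
  change b (a x) = q • x ↔ q • x - 0 = b (a x)
  rw [sub_zero, eq_comm]

/-- A stable retraction composes to the identity only up to a map through a free module; `q` times
this error is absorbed by enlarging the free module. -/
lemma stablyZero_of_retract {q : Q} {X Y : StableMCM Q} (h : Retract X Y) (hY : stablyZero q Y) :
    stablyZero q X := by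
  obtain ⟨i, hi⟩ := (toStable Q).map_surjective (X := X.as) (Y := Y.as) h.i
  obtain ⟨p, hp⟩ := (toStable Q).map_surjective (X := Y.as) (Y := X.as) h.r
  have h1 : (toStable Q).map (i ≫ p) = (toStable Q).map (𝟙 X.as) := by
    rw [Functor.map_comp, hi, hp, h.retract]
    exact ((toStable Q).map_id X.as).symm
  obtain ⟨r, a, b, hab⟩ := (toStable_map_eq_iff _ _).mp h1
  obtain ⟨m, c, d, hcd⟩ := hY
  refine StablyKills.of_factor (P := (Fin m → Q) × (Fin r → Q))
    ((c ∘ₗ i.hom.hom).prod a) ((p.hom.hom ∘ₗ d).coprod (-(q • b))) fun x => ?_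
  change p.hom (d (c (i.hom x))) + (-(q • b (a x))) = q • x
  rw [hcd, ← hab]
  change p.hom (q • i.hom x) + -(q • (p.hom (i.hom x) - x)) = q • x
  have : p.hom (q • i.hom x) = q • p.hom (i.hom x) := map_smul p.hom.hom q _
  rw [this, smul_sub]
  abel

/-- Multiplication by `q` commutes with the projections, and maps into a product are determined by
their components. -/
lemma stablyZero_of_isLimit {q : Q} {J : Type} (X : StableMCM Q)
    (h : (stablyZero q).limitsOfShape (Discrete J) X) : stablyZero q X := by
  obtain ⟨h⟩ := h
  refine (stablyZero_iff q X.as).mpr (h.isLimit.hom_ext fun j => ?_)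
  obtain ⟨p, hp⟩ := (toStable Q).map_surjective (X := X.as) (Y := (h.diag.obj j).as) (h.π.app j)
  change _ ≫ h.π.app j = _ ≫ h.π.app j
  rw [← hp]
  have h1 := (stablyZero_iff q (h.diag.obj j).as).mp (h.prop_diag_obj j)
  have h2 := congrArg (fun φ => (toStable Q).map p ≫ φ) h1
  simp only [← Functor.map_comp] at h2
  have e1 : (ObjectProperty.homMk (q • 𝟙 X.as.obj) : X.as ⟶ X.as) ≫ p =
      p ≫ ObjectProperty.homMk (q • 𝟙 (h.diag.obj j).as.obj) :=
    ObjectProperty.hom_ext _ (ModuleCat.hom_ext (LinearMap.ext fun x => map_smul p.hom.hom q x))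
  have e0 : (ObjectProperty.homMk 0 : X.as ⟶ X.as) ≫ p = p ≫ ObjectProperty.homMk 0 :=
    ObjectProperty.hom_ext _ (ModuleCat.hom_ext (LinearMap.ext fun x => map_zero p.hom.hom))
  rw [← e1, ← e0] at h2
  exact ((toStable Q).map_comp _ _).symm.trans (h2.trans ((toStable Q).map_comp _ _))

/-- Stable vanishing descends from a module to its syzygies. -/
lemma StablyKills.syzygy {q : Q} {X X' : ModuleCat.{u} Q} (s : SyzygySequence Q X X')
    (h : StablyKills q X') : StablyKills q X := by
  obtain ⟨r, a, b, hab⟩ := h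
  obtain ⟨b', hb'⟩ := Module.projective_lifting_property s.proj.hom b s.proj_surjective
  have hb (v) : s.proj (b' v) = b v := LinearMap.congr_fun hb' v
  -- The correction by the lifted factorization sends the free module into `X`, and it vanishes on
  -- `X`, where `u` is therefore `q`.
  let u : (Fin s.rank → Q) →ₗ[Q] (Fin s.rank → Q) := q • LinearMap.id - b' ∘ₗ a ∘ₗ s.proj.hom
  have hu (v) : u v ∈ LinearMap.range s.incl.hom := by
    refine (s.exact (u v)).mp ?_
    change s.proj.hom (q • v - b' (a (s.proj.hom v))) = 0
    rw [map_sub, map_smul]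
    change _ - s.proj (b' _) = 0
    rw [hb, hab]
    exact sub_self _
  let e := LinearEquiv.ofInjective s.incl.hom s.incl_injective
  refine ⟨s.rank, s.incl.hom, e.symm.toLinearMap ∘ₗ LinearMap.codRestrict _ u hu, fun x => ?_⟩
  rw [LinearMap.comp_apply, LinearEquiv.coe_coe, LinearEquiv.symm_apply_eq]
  ext1
  change q • s.incl.hom x - b' (a (s.proj.hom (s.incl.hom x))) = s.incl.hom (q • x)
  have h0 : s.proj.hom (s.incl.hom x) = 0 := s.exact.apply_apply_eq_zero x
  rw [h0, map_zero, map_zero, sub_zero, map_smul]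

/-- Stable vanishing passes from a module to a cosyzygy along which maps to free modules extend. -/
lemma StablyKills.cosyzygy {q : Q} {X X' : ModuleCat.{u} Q} (s : SyzygySequence Q X X')
    (hext : ∀ (r : ℕ) (φ : X →ₗ[Q] (Fin r → Q)),
      ∃ φ' : (Fin s.rank → Q) →ₗ[Q] (Fin r → Q), ∀ x, φ' (s.incl x) = φ x)
    (h : StablyKills q X) : StablyKills q X' := by
  obtain ⟨r, a, b, hab⟩ := h
  obtain ⟨a', ha'⟩ := hext r a
  -- Dually, `u` vanishes on `X`, hence descends to `X'`; the correction dies under `s.proj`.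
  let u : (Fin s.rank → Q) →ₗ[Q] (Fin s.rank → Q) := q • LinearMap.id - s.incl.hom ∘ₗ b ∘ₗ a'
  have hu : LinearMap.ker s.proj.hom ≤ LinearMap.ker u := by
    intro v hv
    obtain ⟨x, rfl⟩ := (s.exact v).mp hv
    change q • s.incl.hom x - s.incl.hom (b (a' (s.incl x))) = 0
    rw [ha', hab, map_smul, sub_self]
  let e := s.proj.hom.quotKerEquivOfSurjective s.proj_surjective
  refine ⟨s.rank, (Submodule.liftQ _ u hu) ∘ₗ e.symm.toLinearMap, s.proj.hom, fun z => ?_⟩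
  obtain ⟨v, rfl⟩ := s.proj_surjective z
  have he : e.symm (s.proj.hom v) = Submodule.Quotient.mk v := by
    rw [LinearEquiv.symm_apply_eq]
    rfl
  rw [LinearMap.comp_apply, LinearEquiv.coe_coe]
  change s.proj.hom (Submodule.liftQ _ u hu (e.symm (s.proj.hom v))) = q • s.proj.hom v
  rw [he, Submodule.liftQ_apply]
  change s.proj.hom (q • v - s.incl.hom (b (a' v))) = _
  have h0 : s.proj.hom (s.incl.hom (b (a' v))) = 0 := s.exact.apply_apply_eq_zero _
  rw [map_sub, h0, sub_zero, map_smul]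

/-- Comparison with the explicit pushout `(B × F) / K` reads off the exactness of `A → B × F → D →
0` from the universal property. -/
lemma exists_of_isPushout {A B F D : ModuleCat.{u} Q} {t : A ⟶ B} {i : A ⟶ F} {j : B ⟶ D}
    {l : F ⟶ D} (h : IsPushout t i j l) :
    Function.Surjective (j.hom.coprod l.hom) ∧
      ∀ y v, j y + l v = 0 → ∃ x, t x = y ∧ i x = -v := by
  constructor
  · rw [← LinearMap.range_eq_top]
    have h0 : ModuleCat.ofHom (LinearMap.range (j.hom.coprod l.hom)).mkQ = 0 := by
      apply h.hom_ext
      · ext y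
        change Submodule.mkQ _ (j.hom y) = 0
        rw [Submodule.mkQ_apply, Submodule.Quotient.mk_eq_zero]
        exact ⟨(y, 0), by simp⟩
      · ext y
        change Submodule.mkQ _ (l.hom y) = 0
        rw [Submodule.mkQ_apply, Submodule.Quotient.mk_eq_zero]
        exact ⟨(0, y), by simp⟩
    have h1 : (LinearMap.range (j.hom.coprod l.hom)).mkQ = 0 := congrArg ModuleCat.Hom.hom h0
    rw [← Submodule.ker_mkQ (LinearMap.range (j.hom.coprod l.hom)), h1, LinearMap.ker_zero]
  · intro y v hyv
    let K := LinearMap.range (t.hom.prod (-i.hom))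
    let j₀ : B ⟶ ModuleCat.of Q ((B × F) ⧸ K) := ModuleCat.ofHom (K.mkQ ∘ₗ LinearMap.inl Q B F)
    let l₀ : F ⟶ ModuleCat.of Q ((B × F) ⧸ K) := ModuleCat.ofHom (K.mkQ ∘ₗ LinearMap.inr Q B F)
    have hw : t ≫ j₀ = i ≫ l₀ := by
      ext x
      change K.mkQ (t.hom x, 0) = K.mkQ (0, i.hom x)
      rw [← sub_eq_zero, ← map_sub, Submodule.mkQ_apply, Submodule.Quotient.mk_eq_zero]
      exact ⟨x, by simp⟩
    have h1 : h.desc j₀ l₀ hw (j y + l v) = K.mkQ (y, v) := by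
      have hj : h.desc j₀ l₀ hw (j y) = j₀ y :=
        congrArg (fun φ : B ⟶ _ => φ y) (h.inl_desc j₀ l₀ hw)
      have hl : h.desc j₀ l₀ hw (l v) = l₀ v :=
        congrArg (fun φ : F ⟶ _ => φ v) (h.inr_desc j₀ l₀ hw)
      have hadd : h.desc j₀ l₀ hw (j y + l v) =
        h.desc j₀ l₀ hw (j y) + h.desc j₀ l₀ hw (l v) := map_add (h.desc j₀ l₀ hw).hom _ _
      rw [hadd, hj, hl]
      change K.mkQ (y, 0) + K.mkQ (0, v) = _
      rw [← map_add, Prod.mk_add_mk, add_zero, zero_add]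
    rw [hyv] at h1
    have h2 : K.mkQ (y, v) = 0 := h1.symm.trans (map_zero (h.desc j₀ l₀ hw).hom)
    rw [Submodule.mkQ_apply, Submodule.Quotient.mk_eq_zero] at h2
    obtain ⟨x, hx⟩ := h2
    refine ⟨x, congrArg Prod.fst hx, ?_⟩
    have h3 : -i x = v := congrArg Prod.snd hx
    rw [← h3, neg_neg]

/-- In a distinguished triangle `X → Y → Z → X[1]`, the product of stable annihilators of `X` and
`Z` annihilates `Y`. -/
lemma stablyZero_of_isDistinguished {q₁ q₂ : Q} {X Y Z X' : StableMCM Q}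
    {s : SyzygySequence Q X.as.obj X'.as.obj} {a : X ⟶ Y} {b : Y ⟶ Z} {c : Z ⟶ X'}
    (h : IsDistinguished s a b c) (hX : stablyZero q₁ X) (hZ : stablyZero q₂ Z) :
    stablyZero (q₁ * q₂) Y := by
  obtain ⟨f, D, j, l, -, e, hpush, -⟩ := h
  obtain ⟨hsurj, hker⟩ := exists_of_isPushout hpush
  have hD : stablyZero q₂ ((toStable Q).obj D) :=
    stablyZero_of_retract ⟨e.inv, e.hom, e.inv_hom_id⟩ hZ
  obtain ⟨r, a₂, b₂, h₂⟩ := hD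
  obtain ⟨m, a₁, b₁, h₁⟩ := hX
  -- Lifting `b₂` to `Y × F` makes `q₂ y` differ from the first component of the lift by an element
  -- `f (t y)`; applying `q₁` then factors that term through a free module too.
  obtain ⟨β, hβ⟩ := Module.projective_lifting_property (j.hom.hom.coprod l.hom) b₂ hsurj
  have hβ' (v) : j.hom (β v).1 + l (β v).2 = b₂ v := LinearMap.congr_fun hβ v
  have key (y : Y.as.obj) : ∃ x, f.hom x = q₂ • y - (β (a₂ (j.hom y))).1 ∧
      s.incl x = (β (a₂ (j.hom y))).2 := by
    obtain ⟨x, hx, hx'⟩ := hker (q₂ • y - (β (a₂ (j.hom y))).1) (-(β (a₂ (j.hom y))).2) (by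
      have h3 : j.hom (q₂ • y - (β (a₂ (j.hom y))).1) =
          q₂ • j.hom y - j.hom (β (a₂ (j.hom y))).1 := by
        change j.hom.hom _ = q₂ • j.hom.hom y - j.hom.hom _
        rw [map_sub, map_smul]
      have h4 : l (-(β (a₂ (j.hom y))).2) = -l (β (a₂ (j.hom y))).2 := map_neg l.hom _
      rw [h3, h4]
      have h5 := hβ' (a₂ (j.hom y))
      have h6 : b₂ (a₂ (j.hom y)) = q₂ • j.hom y := h₂ (j.hom y)
      rw [h6] at h5
      rw [← h5]
      abel)
    exact ⟨x, hx, by rw [hx', neg_neg]⟩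
  let i₀ := LinearEquiv.ofInjective s.incl.hom s.incl_injective
  let w : Y.as.obj →ₗ[Q] (Fin s.rank → Q) := LinearMap.snd Q _ _ ∘ₗ β ∘ₗ a₂ ∘ₗ j.hom.hom
  have hw (y) : w y ∈ LinearMap.range s.incl.hom := by
    obtain ⟨x, -, hx⟩ := key y
    exact ⟨x, hx⟩
  let t : Y.as.obj →ₗ[Q] X.as.obj := i₀.symm.toLinearMap ∘ₗ LinearMap.codRestrict _ w hw
  have ht (y) : f.hom (t y) = q₂ • y - (β (a₂ (j.hom y))).1 := by
    obtain ⟨x, hx, hx'⟩ := key y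
    have : t y = x := by
      rw [LinearMap.comp_apply, LinearEquiv.coe_coe, LinearEquiv.symm_apply_eq]
      ext1
      exact hx'.symm
    rw [this, hx]
  refine StablyKills.of_factor (P := (Fin m → Q) × (Fin r → Q))
    ((a₁ ∘ₗ t).prod (a₂ ∘ₗ j.hom.hom))
    ((f.hom.hom ∘ₗ b₁).coprod (q₁ • (LinearMap.fst Q _ _ ∘ₗ β))) fun y => ?_
  change f.hom (b₁ (a₁ (t y))) + q₁ • (β (a₂ (j.hom y))).1 = (q₁ * q₂) • y
  rw [h₁]
  have h7 : f.hom (q₁ • t y) = q₁ • f.hom (t y) := map_smul f.hom.hom _ _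
  rw [h7, ht, mul_smul, ← smul_add, sub_add_cancel]

/-- A short exact sequence `A → P → B`, together with a cosyzygy of `A` to which maps to free
modules extend, induces a distinguished triangle. -/
lemma star_of_exact {I J : ObjectProperty (StableMCM Q)} {A P B A' : MCM Q}
    (hprod : ∀ r, IsMCM Q (ModuleCat.of Q (B.obj × (Fin r → Q))))
    {i : A.obj →ₗ[Q] P.obj} {p : P.obj →ₗ[Q] B.obj} (hip : Function.Exact i p)
    (hp : Function.Surjective p)
    (s : SyzygySequence Q A.obj A'.obj) (ε : P.obj →ₗ[Q] (Fin s.rank → Q))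
    (hε : ∀ x, ε (i x) = s.incl x)
    (hA : I ((toStable Q).obj A)) (hB : J ((toStable Q).obj B)) :
    star I J ((toStable Q).obj P) := by
  -- The extension `ε` of `s.incl` to `P` splits the pushout of `P` and the free module along `A`,
  -- so it is `B` plus that free module and stably isomorphic to `B`.
  let D : MCM Q := ⟨ModuleCat.of Q (B.obj × (Fin s.rank → Q)), hprod s.rank⟩
  let j : P ⟶ D := ObjectProperty.homMk (ModuleCat.ofHom (p.prod ε))
  let l : ModuleCat.of Q (Fin s.rank → Q) ⟶ D.obj := ModuleCat.ofHom (LinearMap.inr Q _ _)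
  let i' : A ⟶ P := ObjectProperty.homMk (ModuleCat.ofHom i)
  have hpi (x) : p (i x) = 0 := hip.apply_apply_eq_zero x
  have hpush : IsPushout i'.hom s.incl j.hom l := by
    have hw : i'.hom ≫ j.hom = s.incl ≫ l := by
      refine ModuleCat.hom_ext (LinearMap.ext fun x => ?_)
      change (p (i x), ε (i x)) = (0, s.incl x)
      rw [hpi, hε]
    let ψ (t : PushoutCocone i'.hom s.incl) : P.obj →ₗ[Q] t.pt := t.inl.hom - t.inr.hom ∘ₗ ε
    have hψ (t) : LinearMap.ker p ≤ LinearMap.ker (ψ t) := by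
      intro z hz
      obtain ⟨x, rfl⟩ := (hip z).mp hz
      have h1 : t.inl.hom (i x) = t.inr.hom (s.incl x) :=
        congrArg (fun φ : A.obj ⟶ t.pt => φ x) t.condition
      change t.inl.hom (i x) - t.inr.hom (ε (i x)) = 0
      rw [hε, h1, sub_self]
    refine ⟨⟨hw⟩, ⟨PushoutCocone.IsColimit.mk hw (fun t => ModuleCat.ofHom
      (((Submodule.liftQ _ (ψ t) (hψ t)) ∘ₗ
        (p.quotKerEquivOfSurjective hp).symm.toLinearMap).coprod t.inr.hom)) ?_ ?_ ?_⟩⟩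
    · intro t
      ext z
      have he : (p.quotKerEquivOfSurjective hp).symm (p z) = Submodule.Quotient.mk z := by
        rw [LinearEquiv.symm_apply_eq]
        rfl
      change Submodule.liftQ _ (ψ t) (hψ t)
        ((p.quotKerEquivOfSurjective hp).symm (p z)) + t.inr.hom (ε z) = t.inl.hom z
      rw [he, Submodule.liftQ_apply]
      exact sub_add_cancel _ _
    · intro t
      ext1
      exact LinearMap.coprod_inr _ _
    · intro t m h1 h2
      refine ModuleCat.hom_ext (LinearMap.ext ?_)
      rintro ⟨c, v⟩
      obtain ⟨z, rfl⟩ := hp c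
      have h3 : m.hom (p z, ε z) = t.inl.hom z := congrArg (fun φ : P.obj ⟶ t.pt => φ z) h1
      have h4 : m.hom (0, v - ε z) = t.inr.hom (v - ε z) :=
        congrArg (fun φ : ModuleCat.of Q (Fin s.rank → Q) ⟶ t.pt => φ (v - ε z)) h2
      have h5 : m.hom (p z, v) = m.hom (p z, ε z) + m.hom (0, v - ε z) := by
        refine Eq.trans (congrArg m.hom ?_) (map_add m.hom (p z, ε z) (0, v - ε z))
        rw [Prod.mk_add_mk, add_zero, add_sub_cancel]
      refine h5.trans ?_
      have he : (p.quotKerEquivOfSurjective hp).symm (p z) = Submodule.Quotient.mk z := by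
        rw [LinearEquiv.symm_apply_eq]
        rfl
      change _ = Submodule.liftQ _ (ψ t) (hψ t)
        ((p.quotKerEquivOfSurjective hp).symm (p z)) + t.inr.hom v
      rw [he, Submodule.liftQ_apply, h3, h4, map_sub]
      change _ = t.inl.hom z - t.inr.hom (ε z) + t.inr.hom v
      abel
  have hker : LinearMap.ker p ≤ LinearMap.ker (s.proj.hom ∘ₗ ε) := by
    intro z hz
    obtain ⟨x, rfl⟩ := (hip z).mp hz
    change s.proj.hom (ε (i x)) = 0
    rw [hε]
    exact s.exact.apply_apply_eq_zero x
  let π : B.obj →ₗ[Q] A'.obj :=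
    Submodule.liftQ _ _ hker ∘ₗ (p.quotKerEquivOfSurjective hp).symm.toLinearMap
  have hπ (z) : π (p z) = s.proj.hom (ε z) := by
    have he : (p.quotKerEquivOfSurjective hp).symm (p z) = Submodule.Quotient.mk z := by
      rw [LinearEquiv.symm_apply_eq]
      rfl
    change Submodule.liftQ _ _ hker ((p.quotKerEquivOfSurjective hp).symm (p z)) = _
    rw [he, Submodule.liftQ_apply]
    rfl
  -- The sign makes `q` vanish on the image of `P`, where the two contributions are equal.
  let q : D ⟶ A' := ObjectProperty.homMk (ModuleCat.ofHom ((-π).coprod s.proj.hom))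
  let e₁ : B ⟶ D := ObjectProperty.homMk (ModuleCat.ofHom (LinearMap.inl Q _ _))
  let e₂ : D ⟶ B := ObjectProperty.homMk (ModuleCat.ofHom (LinearMap.fst Q _ _))
  let e : (toStable Q).obj B ≅ (toStable Q).obj D :=
    { hom := (toStable Q).map e₁
      inv := (toStable Q).map e₂
      hom_inv_id := by
        rw [← Functor.map_comp]
        exact (toStable Q).map_id B
      inv_hom_id := by
        rw [← Functor.map_comp]
        refine Eq.trans ?_ ((toStable Q).map_id D)
        rw [toStable_map_eq_iff]
        refine ⟨s.rank, LinearMap.snd Q _ _, -LinearMap.inr Q _ _, fun x => ?_⟩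
        obtain ⟨c, v⟩ : B.obj × (Fin s.rank → Q) := x
        change ((c, 0) : B.obj × (Fin s.rank → Q)) - (c, v) = -(0, v)
        rw [Prod.mk_sub_mk, sub_self, zero_sub, Prod.neg_mk, neg_zero] }
  refine ⟨(toStable Q).obj A, (toStable Q).obj B, (toStable Q).obj A', s, (toStable Q).map i',
    (toStable Q).map j ≫ e.inv, e.hom ≫ (toStable Q).map q, hA, hB,
    i', D, j, l, q, e, hpush, ?_, ?_, rfl, ?_, rfl⟩
  · ext z
    change -π (p z) + s.proj.hom (ε z) = 0
    rw [hπ, neg_add_cancel]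
  · ext1
    exact LinearMap.coprod_inr _ _
  · rw [Category.assoc, e.inv_hom_id, Category.comp_id]

end Stable

end BranchedCover

namespace BranchedCover

/-! ### Generation in the stable category of the branched cover -/

section Gen

variable {Q : Type u} [CommRing Q]

lemma le_gen (I : ObjectProperty (StableMCM Q)) : I ≤ gen I := fun _ hX _ _ hP => hP _ hX

lemma gen_eq_of_isClosed {I : ObjectProperty (StableMCM Q)} (hI : IsClosed I) : gen I = I :=
  le_antisymm (fun _ hX => hX I hI le_rfl) (le_gen I)

end Gen

namespace Cover

variable {S : Type u} [CommRing S] [IsRegularLocalRing S] (f : S) {n : ℕ}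

/-- Only passage to a cosyzygy uses the structure of `Q`: the cosyzygy is a lattice, so maps to free
modules extend. -/
lemma isClosed_stablyZero (hf : ¬IsUnit f) (hn : n ≠ 0) (q : Cover f n) :
    IsClosed (stablyZero q) where
  iso := ⟨fun e hX => stablyZero_of_retract e.symm.retract hX⟩
  summands := ⟨stablyZero_of_retract⟩
  sums := ⟨fun _ _ => ⟨fun X hX => stablyZero_of_isLimit X hX⟩⟩
  shifts := fun X X' ⟨s⟩ => by
    obtain ⟨hdom, -⟩ := isDomain_and_exists_isRegular _ S rfl
    refine ⟨StablyKills.cosyzygy s fun r φ => ?_, StablyKills.syzygy s⟩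
    exact exists_extension f hn (i := s.incl.hom) (p := s.proj.hom) s.incl_injective s.exact
      s.proj_surjective ((isMCM_iff_isLattice f hn hf _).mp X'.as.property) φ

/-- The annihilator condition is invariant under stable isomorphism, so the isomorphism closure adds
nothing beyond `sigma_iff`. -/
lemma stableSigma_eq (hf0 : f ≠ 0) (hf : ¬IsUnit f) (hn : n ≠ 0) {k : ℕ} (hk : k ≠ 0) :
    stableSigma (Cover f n) (y f n) k = stablyZero (y f n ^ k) := by
  ext X
  constructor
  · rintro ⟨Z, hZ, ⟨e⟩⟩
    exact stablyZero_of_retract e.symm.retract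
      (((sigma_iff f hf0 hf hn hk Z.obj).mp hZ).2 : stablyZero _ ((toStable _).obj Z))
  · intro hX
    exact ⟨X.as, (sigma_iff f hf0 hf hn hk X.as.obj).mpr ⟨X.as.property, hX⟩, ⟨Iso.refl _⟩⟩

lemma diamond_stablyZero (hf0 : f ≠ 0) (hf : ¬IsUnit f) (hn : n ≠ 0) {j k : ℕ} (hj : j ≠ 0)
    (hjk : j < k) :
    diamond (stablyZero (y f n ^ (k - j))) (stablyZero (y f n ^ j)) =
      stablyZero (y f n ^ k) := by
  obtain ⟨hdom, -⟩ := isDomain_and_exists_isRegular _ S rfl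
  have hfin : Module.Finite S (Cover f n) := (monic f hn).finite_adjoinRoot
  have hfree : Module.Free S (Cover f n) := (monic f hn).free_adjoinRoot
  have hnoeth : IsNoetherianRing (Cover f n) := IsNoetherianRing.of_finite S _
  apply le_antisymm
  · intro X hX
    refine hX _ (isClosed_stablyZero f hf hn _) ?_
    rintro Y ⟨X₁, X₂, X₁', s, a, b, c, h₁, h₂, h⟩
    have := stablyZero_of_isDistinguished h h₁ h₂
    rwa [← pow_add, Nat.sub_add_cancel hjk.le] at this
  · intro X hX
    obtain ⟨A, P, B, i, p, hi, hip, hp, ⟨M, hM, ⟨sA⟩⟩, ⟨N, hN, ⟨sB⟩⟩, ι, θ, hθ⟩ :=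
      exists_extension_retract f hf0 hf hn hj hjk
        ((isMCM_iff_isLattice f hn hf _).mp X.as.property) hX
    have hA := isLattice_of_syzygySequence f hf0 hf hn (Nat.sub_ne_zero_of_lt hjk) M hM A sA
    have hB := isLattice_of_syzygySequence f hf0 hf hn hj N hN B sB
    have hP := IsLattice.of_exact hi hip hp hA hB
    -- This supplies a suspension of `A` with MCM cokernel; `τ` extends to `P` because `B` is a
    -- lattice.
    obtain ⟨m, τ, -, hτ, hA', -⟩ := exists_embedding f hn hA
    have hexact : Function.Exact τ (LinearMap.range τ).mkQ := LinearMap.exact_map_mkQ_range τ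
    obtain ⟨ε, hε⟩ := exists_extension f hn hi hip hp hB τ
    let mk (Z : ModuleCat.{u} (Cover f n)) (hZ : IsLattice S (Cover f n) Z) : MCM (Cover f n) :=
      ⟨Z, (isMCM_iff_isLattice f hn hf Z).mpr hZ⟩
    let s : SyzygySequence (Cover f n) A
        (ModuleCat.of _ ((Fin m → Cover f n) ⧸ LinearMap.range τ)) :=
      ⟨m, ModuleCat.ofHom τ, ModuleCat.ofHom (LinearMap.range τ).mkQ, hτ, hexact,
        Submodule.mkQ_surjective _⟩
    have hstar := star_of_exact (I := stablyZero (y f n ^ (k - j))) (J := stablyZero (y f n ^ j))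
      (A := mk A hA) (P := mk P hP) (B := mk B hB) (A' := mk _ hA')
      (fun r => (isMCM_iff_isLattice f hn hf _).mpr (hB.prod (isLattice_free r))) hip hp s ε hε
      (stablyKills_of_syzygySequence sA) (stablyKills_of_syzygySequence sB)
    intro R hR hle
    have hretract : Retract X ((toStable (Cover f n)).obj (mk P hP)) :=
      { i := (toStable _).map (X := X.as) (ObjectProperty.homMk (ModuleCat.ofHom ι))
        r := (toStable _).map (Y := X.as) (ObjectProperty.homMk (ModuleCat.ofHom θ))
        retract := by
          rw [← Functor.map_comp]
          refine Eq.trans (congrArg _ ?_) ((toStable _).map_id X.as)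
          exact ObjectProperty.hom_ext _ (ModuleCat.hom_ext (LinearMap.ext hθ)) }
    exact hR.summands.of_retract hretract (hle _ hstar)

lemma genIter_stablyZero (hf0 : f ≠ 0) (hf : ¬IsUnit f) (hn : n ≠ 0) (m : ℕ) :
    genIter (stablyZero (y f n ^ 1)) m = stablyZero (y f n ^ (m + 1)) := by
  have h1 := gen_eq_of_isClosed (isClosed_stablyZero f hf hn (y f n ^ 1))
  induction m with
  | zero => exact h1
  | succ m ih =>
    rw [genIter, ih, h1]
    -- Here `j = 1` and `k = m + 2`: each further factor raises the exponent by one.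
    exact diamond_stablyZero f hf0 hf hn one_ne_zero (by lia : 1 < m + 1 + 1)

end Cover

end BranchedCover

theorem mainTheorem7 (S : Type u) [CommRing S] [IsRegularLocalRing S]
    (f : S) (hf0 : f ≠ 0) (hf : ¬ IsUnit f) (n : ℕ) (hn : 2 ≤ n) :
    (∀ j k : ℕ, 1 ≤ j → j < k → k ≤ n →
      BranchedCover.stableSigma (BranchedCover.Cover f n) (BranchedCover.Cover.y f n) k =
        BranchedCover.diamond
          (BranchedCover.stableSigma (BranchedCover.Cover f n) (BranchedCover.Cover.y f n) (k - j))
          (BranchedCover.stableSigma (BranchedCover.Cover f n) (BranchedCover.Cover.y f n) j)) ∧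
    (IsUnit (n : S) →
      BranchedCover.IsMCM (BranchedCover.Cover f n) =
        BranchedCover.Sigma (BranchedCover.Cover f n) (BranchedCover.Cover.y f n) (n - 1) ∧
      (⊤ : ObjectProperty (BranchedCover.StableMCM (BranchedCover.Cover f n))) =
        BranchedCover.stableSigma (BranchedCover.Cover f n) (BranchedCover.Cover.y f n) (n - 1) ∧
      BranchedCover.stableSigma (BranchedCover.Cover f n) (BranchedCover.Cover.y f n) (n - 1) =
        BranchedCover.genIter
          (BranchedCover.stableSigma (BranchedCover.Cover f n) (BranchedCover.Cover.y f n) 1)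
          (n - 2)) := by
  open BranchedCover Cover in
  have hn0 : n ≠ 0 := by lia
  have hn1 : n - 1 ≠ 0 := by lia
  refine ⟨fun j k hj hjk _ => ?_, fun hu => ?_⟩
  · have hj0 : j ≠ 0 := by lia
    rw [stableSigma_eq f hf0 hf hn0 (by lia : k ≠ 0),
      stableSigma_eq f hf0 hf hn0 (Nat.sub_ne_zero_of_lt hjk), stableSigma_eq f hf0 hf hn0 hj0,
      diamond_stablyZero f hf0 hf hn0 hj0 hjk]
  · have key (X : ModuleCat.{u} (Cover f n)) (hX : IsMCM (Cover f n) X) :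
        StablyKills (y f n ^ (n - 1)) X :=
      stablyKills_of_isUnit f hn0 hu ((isMCM_iff_isLattice f hn0 hf X).mp hX)
    refine ⟨?_, ?_, ?_⟩
    · ext X
      rw [sigma_iff f hf0 hf hn0 hn1]
      exact ⟨fun hX => ⟨hX, key X hX⟩, And.left⟩
    · rw [stableSigma_eq f hf0 hf hn0 hn1, eq_comm, eq_top_iff]
      exact fun X _ => key X.as.obj X.as.property
    · rw [stableSigma_eq f hf0 hf hn0 hn1, stableSigma_eq f hf0 hf hn0 one_ne_zero,
        genIter_stablyZero f hf0 hf hn0, show n - 2 + 1 = n - 1 by lia]
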